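/- Let $E\cup\{\partial\}$ be a metric space with metric $d$ and Borel $\sigma$-algebra, $\partial\notin E$, and let $(X_t)_{t\ge 0}$ be a time-homogeneous Markov process on $E\cup\{\partial\}$ with laws $(\mathbb P_x)_{x\in E}$ depending measurably on $x$, $\mathbb P_x(X_0=x)=1$. Put $\tau=\inf\{t\ge 0: X_t=\partial\}$ and assume that $X_t=\partial$ for all $t\ge\tau$ and that, for all $x\in E$ and $t\ge 0$, $\mathbb P_x(\tau<\infty)=1$ and $\mathbb P_x(\tau>t)>0$. Assume also that $X_t\to x$ in $\mathbb P_x$-probability as $t\downarrow 0$ for every $x\in E$ (as is the case when the paths are right-continuous). For a probability measure $\mu$ on $E$ let $\mathbb P_\mu=\int\mathbb P_x\,\mu(dx)$. Let $P_tf(x)=\mathbb E_x[f(X_t)\mathbf 1_{\tau>t}]$ and $\mu P_t=\mathbb P_\mu(X_t\in\cdot,\tau>t)$. Say that a measurable $f:E\to\mathbb R$ is in $\mathcal D(\mathcal L)$ if $P_tf(x)$ is an absolutely convergent integral for all $t\ge 0$ and $x\in E$ and $\mathcal Lf(x)=\lim_{t\downarrow0}(P_tf(x)-f(x))/t$ exists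 in $\mathbb R$ for all $x\in E$. For a measurable $f>0$ with $\mu(f)=\int f\,d\mu<\infty$ let $f*\mu$ be the probability measure $f(x)\mu(dx)/\mu(f)$, and let $\chi_2(\mu|\nu)=\left(\int(\frac{d\mu}{d\nu}-1)^2d\nu\right)^{1/2}\in[0,\infty]$ if $\mu\ll\nu$ and $\chi_2(\mu|\nu)=+\infty$ otherwise. Let $\mathcal W_1(\mu,\nu)=\inf\mathbb E[d(Y,Z)]\in[0,\infty]$, the infimum being over all couplings $(Y,Z)$ of $\mu$ and $\nu$. Let $x_0\in E$, $\psi(x)=1+d(x,x_0)$, let $\alpha$ be a probability measure on $E$, $\eta:E\to(0,\infty)$ a measurable function, $\lambda_0>0$ and $C_P\in(0,\infty)$ such that: (P1) $\alpha P_t=e^{-\lambda_0t}\alpha$ and $P_t\eta(x)=e^{-\lambda_0t}\eta(x)$ for all $t\ge0$, $x\in E$, and $\alpha(\eta)=1$; (P2) with $\beta=\eta*\alpha$ and $$\widetilde{\mathcal L}f=\frac{\mathcal L(f\eta)-f\mathcal L\eta}{\eta}$$ (which is $\mathcal Lf+\Gamma(f,\eta)/\eta$, where $\Gamma(f,g)=\mathcal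 L(fg)-f\mathcal Lg-g\mathcal Lf$, whenever also $f\in\mathcal D(\mathcal L)$), one has $$\mathrm{Var}_\beta(f)\le -C_P\int_E f\,\widetilde{\mathcal L}f\,d\beta$$ for every $f\in L^2(\beta)$ such that $f\eta\in\mathcal D(\mathcal L)$ and $\frac1\eta\cdot\frac{P_t(f\eta)-f\eta}{t}\to\frac1\eta\mathcal L(f\eta)$ also in $L^2(\beta)$ as $t\downarrow0$; (P3) $\alpha(\psi)<\infty$ and $\alpha(\psi^2/\eta)<\infty$. Then for every probability measure $\mu$ on $E$ with $\mu(\eta)<\infty$ there exists $t_\mu\ge0$ such that, for all $t\ge t_\mu$, $$\mathcal W_1\big(\mathbb P_\mu(X_t\in\cdot\mid\tau>t),\alpha\big)\le C_\psi\,\chi_2(\eta*\mu\,|\,\eta*\alpha)\,e^{-t/C_P},\qquad C_\psi=(a+b\,\alpha(\psi))\,\alpha(\psi^2/\eta)^{1/2},$$ where $a,b>0$ are universal constants. -/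

import Mathlib

open MeasureTheory ProbabilityTheory Filter Topology
open scoped NNReal ENNReal

noncomputable section

namespace QSD

/-! ### Measures: weighting, chi-square divergence, Wasserstein distance -/

section Measures

variable {F : Type*} [MeasurableSpace F]

/-- The probability measure `f * μ`, i.e. `f(x) μ(dx) / μ(f)`, for `f` positive with `μ(f) < ∞`. -/
def weighted (f : F → ℝ) (μ : Measure F) : Measure F :=
  (∫⁻ x, ENNReal.ofReal (f x) ∂μ)⁻¹ • μ.withDensity (fun x => ENNReal.ofReal (f x))

open Classical in
/-- The divergence `χ₂(μ | ν)`, the `L²(ν)`-norm of `dμ/dν - 1` if `μ ≪ ν`, and `∞` otherwise. -/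
def chi2 (μ ν : Measure F) : ℝ≥0∞ :=
  if μ ≪ ν then
    (∫⁻ x, ENNReal.ofReal (((μ.rnDeriv ν x).toReal - 1) ^ 2) ∂ν) ^ (1 / 2 : ℝ)
  else ⊤

/-- The 1-Wasserstein distance: infimum of `E[d(X,Y)]` over all couplings, here given by
their joint law. -/
def wasserstein1 [MetricSpace F] (μ ν : Measure F) : ℝ≥0∞ :=
  ⨅ (π : Measure (F × F)) (_ : π.fst = μ) (_ : π.snd = ν), ∫⁻ p, edist p.1 p.2 ∂π

end Measures

/-! ### Absorbed Markov processes -/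

section Absorbed

variable {S Ω : Type*} [MetricSpace S] [MeasurableSpace S] [MeasurableSpace Ω]

/-- The state space `E`, i.e. `S = E ∪ {cem}` without the cemetery point. -/
abbrev Live (cem : S) : Type _ := {x : S // x ≠ cem}

variable {cem : S}

open Classical in
/-- Extension of a function on `E` to `S = E ∪ {cem}` by the value `0` at the cemetery. -/
def extendZero (f : Live cem → ℝ) (y : S) : ℝ :=
  if h : y ≠ cem then f ⟨y, h⟩ else 0

/-- The absorption time `inf {t ≥ 0 : X_t = cem}`, equal to `∞` if the cemetery is never hit. -/
def absorptionTime (cem : S) (X : ℝ≥0 → Ω → S) (ω : Ω) : ℝ≥0∞ :=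
  ⨅ (t : ℝ≥0) (_ : X t ω = cem), (t : ℝ≥0∞)

/-- `P_t f (x) = E_x[f(X_t) 1_{τ > t}]`. The indicator is built into `extendZero`, since for an
absorbed process `τ > t` holds if and only if `X_t ≠ cem`
(see `AbsorbedMarkovProcess.lt_tau_iff`). -/
def killedExpectation (X : ℝ≥0 → Ω → S) (P : Kernel (Live cem) Ω) (t : ℝ≥0)
    (f : Live cem → ℝ) (x : Live cem) : ℝ :=
  ∫ ω, extendZero f (X t ω) ∂(P x)

/-- The sigma-algebra generated by `X_r`, `r ≤ s`. -/
abbrev past (X : ℝ≥0 → Ω → S) (s : ℝ≥0) : MeasurableSpace Ω :=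
  ⨆ r : Set.Iic s, MeasurableSpace.comap (X r) inferInstance

/-- A time-homogeneous Markov process on `S = E ∪ {cem}`, absorbed at `cem`, with the laws
`P_x`, `x ∈ E`. Absorption is almost surely finite, and survival up to any fixed time has positive
probability. The only regularity in time is that `X_t → x` in `P_x`-probability
as `t → 0` (automatic for processes with right-continuous paths). -/
structure AbsorbedMarkovProcess (S Ω : Type*) [MetricSpace S] [MeasurableSpace S] [BorelSpace S]
    [MeasurableSpace Ω] (cem : S) where
  X : ℝ≥0 → Ω → S
  measurable_X : ∀ t, Measurable (X t)
  P : Kernel (Live cem) Ω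
  isMarkovKernel : IsMarkovKernel P
  start : ∀ x : Live cem, ∀ᵐ ω ∂(P x), X 0 ω = x
  absorbed : ∀ (ω : Ω) (t : ℝ≥0), absorptionTime cem X ω ≤ t → X t ω = cem
  absorption_finite : ∀ x, ∀ᵐ ω ∂(P x), absorptionTime cem X ω < ⊤
  survival_pos : ∀ (x : Live cem) (t : ℝ≥0), 0 < P x {ω | (t : ℝ≥0∞) < absorptionTime cem X ω}
  markov : ∀ (x : Live cem) (s t : ℝ≥0) (f : Live cem → ℝ), Measurable f →
    (∃ M, ∀ y, |f y| ≤ M) →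
    (P x)[fun ω => extendZero f (X (s + t) ω) | past X s]
      =ᵐ[P x] fun ω => extendZero (killedExpectation X P t f) (X s ω)
  continuous_zero : ∀ x : Live cem,
    TendstoInMeasure (P x) X (𝓝[>] (0 : ℝ≥0)) (fun _ => (x : S))

namespace AbsorbedMarkovProcess

variable [BorelSpace S] (Z : AbsorbedMarkovProcess S Ω cem)

/-- The absorption time of the process. -/
def tau (ω : Ω) : ℝ≥0∞ := absorptionTime cem Z.X ω

theorem lt_tau_iff (t : ℝ≥0) (ω : Ω) : (t : ℝ≥0∞) < Z.tau ω ↔ Z.X t ω ≠ cem := by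
  constructor
  · intro h hX
    exact absurd (iInf₂_le t hX : absorptionTime cem Z.X ω ≤ t) (not_le.mpr h)
  · intro h
    by_contra hlt
    exact h (Z.absorbed ω t (not_lt.mp hlt))

/-- The law `P_μ = ∫ P_x μ(dx)`. -/
def lawFrom (μ : Measure (Live cem)) : Measure Ω := μ.bind Z.P

/-- The measure `μ P_t = P_μ(X_t ∈ ·, τ > t)` on `E`. -/
def subLaw (μ : Measure (Live cem)) (t : ℝ≥0) : Measure (Live cem) :=
  (((Z.lawFrom μ).restrict {ω | (t : ℝ≥0∞) < Z.tau ω}).map (Z.X t)).comap Subtype.val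

/-- The conditioned law `P_μ(X_t ∈ · | τ > t)` on `E`. -/
def condLaw (μ : Measure (Live cem)) (t : ℝ≥0) : Measure (Live cem) :=
  ((ProbabilityTheory.cond (Z.lawFrom μ) {ω | (t : ℝ≥0∞) < Z.tau ω}).map (Z.X t)).comap
    Subtype.val

/-- The sub-Markovian semigroup `P_t f (x) = E_x[f(X_t) 1_{τ > t}]`. -/
def semigroup (t : ℝ≥0) (f : Live cem → ℝ) (x : Live cem) : ℝ :=
  killedExpectation Z.X Z.P t f x

/-- `f` belongs to the domain of the generator: `P_t f` is well defined and
`(P_t f(x) - f(x)) / t` has a limit as `t → 0`, for every `x`. -/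
def InDomain (f : Live cem → ℝ) : Prop :=
  Measurable f ∧ (∀ t x, Integrable (fun ω => extendZero f (Z.X t ω)) (Z.P x)) ∧
    ∀ x, ∃ l : ℝ,
      Tendsto (fun t : ℝ≥0 => (Z.semigroup t f x - f x) / t) (𝓝[>] 0) (𝓝 l)

/-- The generator `L f (x) = lim_{t → 0} (P_t f(x) - f(x)) / t`. -/
def generator (f : Live cem → ℝ) (x : Live cem) : ℝ :=
  limUnder (𝓝[>] (0 : ℝ≥0)) (fun t : ℝ≥0 => (Z.semigroup t f x - f x) / t)

/-- The carré du champ `Γ(f,g) = L(fg) - f L g - (L f) g`. -/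
def carreDuChamp (f g : Live cem → ℝ) (x : Live cem) : ℝ :=
  Z.generator (fun y => f y * g y) x - f x * Z.generator g x - Z.generator f x * g x

/-- The operator `L f + Γ(f,η)/η`, written as `(L(fη) - f L η)/η` so that it makes sense as soon as
`η` and `fη` are in the domain of `L` (the two occurrences of `L f` cancel). It is the generator of
the Doob transform `e^{λ₀ t} P_t(fη)/η`. -/
def doobGenerator (η f : Live cem → ℝ) (x : Live cem) : ℝ :=
  (Z.generator (fun y => f y * η y) x - f x * Z.generator η x) / η x

theorem doobGenerator_eq {η : Live cem → ℝ} (hη : ∀ x, 0 < η x) (f : Live cem → ℝ)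
    (x : Live cem) :
    Z.doobGenerator η f x = Z.generator f x + Z.carreDuChamp f η x / η x := by
  have := (hη x).ne'
  unfold doobGenerator carreDuChamp
  field_simp
  ring

/-- For `f` such that both integrals exist, the integral of `f (L f + Γ(f,η)/η)` against `η*α` is
the sum of `∫ f L f d(η*α)` and `∫ f Γ(f,η) dα`. -/
theorem integral_doobGenerator {α : Measure (Live cem)} {η : Live cem → ℝ}
    (hm : Measurable η) (hη : ∀ x, 0 < η x) (hi : Integrable η α) (h1 : ∫ x, η x ∂α = 1)
    (f : Live cem → ℝ)
    (hL : Integrable (fun x => f x * Z.generator f x) (weighted η α))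
    (hG : Integrable (fun x => f x * Z.carreDuChamp f η x) α) :
    ∫ x, f x * Z.doobGenerator η f x ∂(weighted η α) =
      ∫ x, f x * Z.generator f x ∂(weighted η α) + ∫ x, f x * Z.carreDuChamp f η x ∂α := by
  have hw : weighted η α = α.withDensity (fun x => ((η x).toNNReal : ℝ≥0∞)) := by
    have : ∫⁻ x, ENNReal.ofReal (η x) ∂α = 1 := by
      rw [← ofReal_integral_eq_lintegral_ofReal hi (ae_of_all _ fun x => (hη x).le), h1]
      simp
    unfold weighted
    rw [this, inv_one, one_smul]
    rfl
  have hmn : Measurable fun x => (η x).toNNReal := hm.real_toNNReal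
  rw [hw, integrable_withDensity_iff_integrable_smul hmn] at hL
  rw [hw, integral_withDensity_eq_integral_smul hmn, integral_withDensity_eq_integral_smul hmn,
    ← integral_add hL hG]
  refine integral_congr_ae (ae_of_all _ fun x => ?_)
  have hne := (hη x).ne'
  simp only [Z.doobGenerator_eq hη, NNReal.smul_def, Real.coe_toNNReal _ (hη x).le, smul_eq_mul]
  field_simp

/-- The functions `f` for which the energy `∫ f L f d(η*α) + ∫ f Γ(f,η) dα` is well defined as
an energy in `L²(β)`, `β = η*α`: `f` is in `L²(β)`, `fη` is in the domain of `L`, and the limit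
defining `L(fη)/η` also holds in `L²(β)`. -/
def InEnergyDomain (η : Live cem → ℝ) (β : Measure (Live cem)) (f : Live cem → ℝ) : Prop :=
  Measurable f ∧ MemLp f 2 β ∧ Z.InDomain (fun y => f y * η y) ∧
    Tendsto (fun t : ℝ≥0 =>
      eLpNorm (fun x => ((Z.semigroup t (fun y => f y * η y) x - f x * η x) / t
        - Z.generator (fun y => f y * η y) x) / η x) 2 β) (𝓝[>] 0) (𝓝 0)

/-- The assumptions on a quasi-stationary distribution `α`, a right eigenfunction `η`, the
eigenvalue parameter `lam`, the Poincaré constant `C` and the weight `ψ`. -/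
structure PoincareAssumptions (α : Measure (Live cem)) (η : Live cem → ℝ) (lam C : ℝ)
    (ψ : Live cem → ℝ) : Prop where
  isProbabilityMeasure : IsProbabilityMeasure α
  lam_pos : 0 < lam
  quasiStationary : ∀ t : ℝ≥0,
    Z.subLaw α t = ENNReal.ofReal (Real.exp (-lam * t)) • α
  measurable_eta : Measurable η
  eta_pos : ∀ x, 0 < η x
  integrable_eta : Integrable η α
  integral_eta : ∫ x, η x ∂α = 1
  eigenfunction : ∀ (t : ℝ≥0) (x : Live cem),
    Integrable (fun ω => extendZero η (Z.X t ω)) (Z.P x) ∧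
      Z.semigroup t η x = Real.exp (-lam * t) * η x
  C_pos : 0 < C
  poincare : ∀ f : Live cem → ℝ, Z.InEnergyDomain η (weighted η α) f →
    variance f (weighted η α) ≤ -C * ∫ x, f x * Z.doobGenerator η f x ∂(weighted η α)
  measurable_psi : Measurable ψ
  one_le_psi : ∀ x, 1 ≤ ψ x
  integrable_psi : Integrable ψ α
  integrable_psi_sq_div : Integrable (fun x => ψ x ^ 2 / η x) α

end AbsorbedMarkovProcess

end Absorbed

end QSD

end

/-! The eigenfunction `η` turns the killed semigroup into a conservative one: the Doob transform
`Q_t f = e^{λ₀t} P_t(fη)/η` is a Markov semigroup with invariant probability measure `β = η * α`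
(`stationarySemigroup`). The operator in the Poincaré inequality is its generator, so formally `d/dt
∫ (Q_t f)² dβ = 2 ∫ Q_t f · L̃ Q_t f dβ ≤ -(2/C) ∫ (Q_t f)² dβ` for centred `f`, and `Q_t` contracts
to the mean in `L²(β)` at rate `1/C`.

The computation cannot be run on `Q_t g` itself, which need not lie in the domain of the generator.
For bounded continuous `g` it is run on `U_t = ∫_t^{t+h} Q_s g ds`, whose right derivative `Q_{t+h}
g - Q_t g` exists at every point and is bounded; this puts `U_t` in the energy domain
(`inEnergyDomain_flowMean`). Gronwall gives the decay of `∫ U_t² dβ`; dividing by `h²` and letting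
`h → 0` gives that of `Q_t g`, and density of bounded continuous functions gives all of `L²(β)`
(`eLpNorm_decay`). The right continuity of `s ↦ Q_s g` that this needs comes from `X_t → x` in
probability (`tendsto_doobKernel_compl_ball`).

By duality with `dν/dβ - 1`, where `ν = η * μ`, the error `|νQ_t(F) - β(F)|` is at most `χ₂(ν|β)
e^{-t/C} ‖F‖_{L²(β)}` (`enorm_integral_bind_sub_le`). Undoing the Doob transform, the conditioned
law integrates `f` to `νQ_t(f/η) / νQ_t(1/η)` (`condLaw_eq`). For `|f| ≤ ψ`, `‖f/η‖²_{L²(β)} =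
α(f²/η) ≤ α(ψ²/η)`, so numerator and denominator are within `δ(t) = χ₂ e^{-t/C} α(ψ²/η)^{1/2}` of
`α(f)` and `1`. Once `δ(t) ≤ 1/2` the quotient is within `2(1 + α(ψ)) δ(t)` of `α(f)`, hence `a = b
= 2`; a bound uniform over `|f| ≤ ψ` controls `W₁` (`wasserstein1_le_of_abs_le`). -/

namespace QSD

/-! ### Killed transition kernels on `E` and the Chapman–Kolmogorov equation. -/

section ExtendZero

variable {S : Type*} {cem : S}

theorem extendZero_val (f : Live cem → ℝ) (x : Live cem) : extendZero f (x : S) = f x := by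
  simp [extendZero, x.2]

theorem extendZero_of_notMem (f : Live cem → ℝ) {y : S}
    (hy : y ∉ Set.range (Subtype.val : Live cem → S)) : extendZero f y = 0 := by
  have : y = cem := by simpa using hy
  simp [extendZero, this]

variable [MetricSpace S] [MeasurableSpace S] [BorelSpace S]

theorem measurableEmbedding_live : MeasurableEmbedding (Subtype.val : Live cem → S) :=
  .subtype_coe (measurableSet_singleton cem).compl

theorem measurable_extendZero {f : Live cem → ℝ} (hf : Measurable f) :
    Measurable (extendZero f) := by
  have : extendZero f = Function.extend Subtype.val f (fun _ => 0) := by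
    ext y
    by_cases hy : y ∈ Set.range (Subtype.val : Live cem → S)
    · obtain ⟨x, rfl⟩ := hy
      rw [extendZero_val, measurableEmbedding_live.injective.extend_apply]
    · rw [extendZero_of_notMem f hy, Function.extend_apply']
      simpa using hy
  rw [this]
  exact measurableEmbedding_live.measurable_extend hf measurable_const

theorem integral_extendZero (ν : Measure S) (f : Live cem → ℝ) :
    ∫ y, extendZero f y ∂ν = ∫ x, f x ∂(ν.comap Subtype.val) := by
  have h := (measurableEmbedding_live (cem := cem)).integral_map (μ := ν.comap Subtype.val)
    (extendZero f)
  rw [measurableEmbedding_live.map_comap,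
    setIntegral_eq_integral_of_forall_compl_eq_zero
      (fun y hy => extendZero_of_notMem f hy)] at h
  simpa only [extendZero_val] using h

theorem integrable_extendZero_iff (ν : Measure S) (f : Live cem → ℝ) :
    Integrable (extendZero f) ν ↔ Integrable f (ν.comap Subtype.val) := by
  have h := (measurableEmbedding_live (cem := cem)).integrable_map_iff
    (μ := ν.comap Subtype.val) (g := extendZero f)
  rw [measurableEmbedding_live.map_comap] at h
  have h2 : extendZero f ∘ Subtype.val = f := funext (extendZero_val f)
  rw [h2] at h
  rw [← h]
  refine (integrableOn_iff_integrable_of_support_subset fun y hy => ?_).symm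
  by_contra hn
  exact hy (extendZero_of_notMem f hn)

end ExtendZero

namespace AbsorbedMarkovProcess

variable {S Ω : Type*} [MetricSpace S] [MeasurableSpace S] [BorelSpace S] [MeasurableSpace Ω]
  {cem : S} (Z : AbsorbedMarkovProcess S Ω cem)

/-- The sub-Markovian transition kernel on `E`: the law of `X_t` under `P_x` on `{τ > t}`. -/
noncomputable def liveKernel (t : ℝ≥0) : Kernel (Live cem) (Live cem) :=
  (Z.P.map (Z.X t)).comapRight measurableEmbedding_live

instance : IsMarkovKernel Z.P := Z.isMarkovKernel

instance (t : ℝ≥0) : IsFiniteKernel (Z.liveKernel t) := by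
  unfold liveKernel
  infer_instance

theorem liveKernel_apply (t : ℝ≥0) (x : Live cem) :
    Z.liveKernel t x = ((Z.P x).map (Z.X t)).comap Subtype.val := by
  rw [liveKernel, Kernel.comapRight_apply, Kernel.map_apply _ (Z.measurable_X t)]

theorem liveKernel_apply' (t : ℝ≥0) (x : Live cem) {A : Set (Live cem)} (hA : MeasurableSet A) :
    Z.liveKernel t x A = Z.P x (Z.X t ⁻¹' (Subtype.val '' A)) := by
  rw [liveKernel, Kernel.comapRight_apply' _ _ _ hA, Kernel.map_apply' _ (Z.measurable_X t) _
    (measurableEmbedding_live.measurableSet_image.mpr hA)]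

theorem integral_extendZero_X (t : ℝ≥0) (x : Live cem) {f : Live cem → ℝ} (hf : Measurable f) :
    ∫ ω, extendZero f (Z.X t ω) ∂(Z.P x) = ∫ y, f y ∂(Z.liveKernel t x) := by
  rw [liveKernel_apply, ← integral_extendZero,
    integral_map (Z.measurable_X t).aemeasurable
      (measurable_extendZero hf).aestronglyMeasurable]

theorem semigroup_eq (t : ℝ≥0) (x : Live cem) {f : Live cem → ℝ} (hf : Measurable f) :
    Z.semigroup t f x = ∫ y, f y ∂(Z.liveKernel t x) :=
  Z.integral_extendZero_X t x hf

theorem integrable_extendZero_X_iff (t : ℝ≥0) (x : Live cem) {f : Live cem → ℝ}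
    (hf : Measurable f) :
    Integrable (fun ω => extendZero f (Z.X t ω)) (Z.P x) ↔
      Integrable f (Z.liveKernel t x) := by
  rw [liveKernel_apply, ← integrable_extendZero_iff,
    integrable_map_measure (measurable_extendZero hf).aestronglyMeasurable
      (Z.measurable_X t).aemeasurable]
  rfl

theorem setOf_lt_tau (t : ℝ≥0) :
    {ω | (t : ℝ≥0∞) < Z.tau ω} = Z.X t ⁻¹' (Set.range (Subtype.val : Live cem → S)) := by
  ext ω
  simp [Z.lt_tau_iff]

theorem subLaw_eq_bind (μ : Measure (Live cem)) (t : ℝ≥0) :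
    Z.subLaw μ t = μ.bind (Z.liveKernel t) := by
  ext A hA
  have hA' := measurableEmbedding_live.measurableSet_image.mpr hA
  rw [subLaw, Measure.comap_apply _ Subtype.val_injective
      (fun s hs => measurableEmbedding_live.measurableSet_image.mpr hs) _ hA,
    Measure.map_apply (Z.measurable_X t) hA', Measure.restrict_apply (Z.measurable_X t hA'),
    Z.setOf_lt_tau, ← Set.preimage_inter,
    Set.inter_eq_left.mpr (Set.image_subset_range _ _), lawFrom,
    Measure.bind_apply (Z.measurable_X t hA') (Kernel.aemeasurable _),
    Measure.bind_apply hA (Kernel.aemeasurable _)]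
  simp_rw [Z.liveKernel_apply' t _ hA]

theorem condLaw_eq_smul (μ : Measure (Live cem)) (t : ℝ≥0) :
    Z.condLaw μ t = (Z.subLaw μ t Set.univ)⁻¹ • Z.subLaw μ t := by
  have h : Z.subLaw μ t Set.univ = Z.lawFrom μ {ω | (t : ℝ≥0∞) < Z.tau ω} := by
    rw [subLaw, Measure.comap_apply _ Subtype.val_injective
      (fun s hs => measurableEmbedding_live.measurableSet_image.mpr hs) _ .univ,
      Set.image_univ, Measure.map_apply (Z.measurable_X t)
        measurableEmbedding_live.measurableSet_range, ← Z.setOf_lt_tau,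
      Measure.restrict_apply_self]
  rw [h, condLaw, subLaw, ProbabilityTheory.cond, Measure.map_smul, Measure.comap_smul]

theorem past_le (s : ℝ≥0) : past Z.X s ≤ (inferInstance : MeasurableSpace Ω) :=
  iSup_le fun r => (Z.measurable_X r).comap_le

theorem measurable_X_past (s : ℝ≥0) : Measurable[past Z.X s] (Z.X s) :=
  Measurable.of_comap_le
    (le_iSup (fun r : Set.Iic s => MeasurableSpace.comap (Z.X r) inferInstance)
      ⟨s, Set.mem_Iic.mpr le_rfl⟩)

theorem liveKernel_univ_le (t : ℝ≥0) (x : Live cem) (B : Set (Live cem)) :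
    Z.liveKernel t x B ≤ 1 := by
  refine (measure_mono (Set.subset_univ B)).trans ?_
  rw [Z.liveKernel_apply' t x .univ]
  exact prob_le_one

/-- Integrate the conditional form of the Markov property, for the indicator of `B`, over the past
event `{X_s ∈ A}`. -/
theorem markov_two_times (x : Live cem) (s t : ℝ≥0) {A : Set S} {B : Set (Live cem)}
    (hA : MeasurableSet A) (hB : MeasurableSet B) :
    Z.P x (Z.X s ⁻¹' A ∩ Z.X (s + t) ⁻¹' (Subtype.val '' B)) =
      ∫⁻ y in Subtype.val ⁻¹' A, Z.liveKernel t y B ∂(Z.liveKernel s x) := by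
  set f : Live cem → ℝ := B.indicator 1 with hf
  have hfm : Measurable f := measurable_one.indicator hB
  have hfb : ∃ M, ∀ y, |f y| ≤ M := ⟨1, fun y => by
    by_cases hy : y ∈ B <;> simp [hf, hy]⟩
  have hB' := measurableEmbedding_live.measurableSet_image.mpr hB
  have hA' : MeasurableSet (Subtype.val ⁻¹' A : Set (Live cem)) := measurable_subtype_coe hA
  have hm := Z.markov x s t f hfm hfb
  have hfX : ∀ ω, extendZero f (Z.X (s + t) ω)
      = (Z.X (s + t) ⁻¹' (Subtype.val '' B)).indicator (1 : Ω → ℝ) ω := by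
    intro ω
    by_cases hω : Z.X (s + t) ω ∈ Set.range (Subtype.val : Live cem → S)
    · obtain ⟨y, hy⟩ := hω
      rw [← hy, extendZero_val]
      by_cases hyB : y ∈ B
      · rw [Set.indicator_of_mem (by rw [Set.mem_preimage, ← hy]; exact ⟨y, hyB, rfl⟩)]
        simp [hf, hyB]
      · rw [Set.indicator_of_notMem]
        · simp [hf, hyB]
        · rw [Set.mem_preimage, ← hy]
          rintro ⟨z, hz, hzy⟩
          exact hyB (Subtype.val_injective hzy ▸ hz)
    · rw [extendZero_of_notMem f hω, Set.indicator_of_notMem]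
      exact fun h => hω (Set.image_subset_range _ _ h)
  have hint : Integrable (fun ω => extendZero f (Z.X (s + t) ω)) (Z.P x) := by
    simp_rw [hfX]
    exact (integrable_const (1 : ℝ)).indicator (Z.measurable_X _ hB')
  have hAp : MeasurableSet[past Z.X s] (Z.X s ⁻¹' A) := Z.measurable_X_past s hA
  have h1 := setIntegral_condExp (μ := Z.P x) (Z.past_le s) hint hAp
  rw [setIntegral_congr_ae (g := fun ω => extendZero (killedExpectation Z.X Z.P t f) (Z.X s ω))
    (Z.measurable_X s hA) (hm.mono fun ω h _ => h)] at h1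
  have hk : killedExpectation Z.X Z.P t f = fun y => (Z.liveKernel t y).real B := by
    ext y
    rw [killedExpectation, Z.integral_extendZero_X t y hfm, hf, integral_indicator_one hB]
  have hkm : Measurable fun y => (Z.liveKernel t y).real B :=
    (Kernel.measurable_coe _ hB).ennreal_toReal
  have hl : ∫ ω in Z.X s ⁻¹' A, extendZero (killedExpectation Z.X Z.P t f) (Z.X s ω) ∂(Z.P x) =
      ∫ y in Subtype.val ⁻¹' A, (Z.liveKernel t y).real B ∂(Z.liveKernel s x) := by
    rw [← integral_indicator (Z.measurable_X s hA), ← integral_indicator hA',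
      ← Z.integral_extendZero_X s x (hkm.indicator hA'), hk]
    congr 1
    ext ω
    by_cases hω : Z.X s ω ∈ Set.range (Subtype.val : Live cem → S)
    · obtain ⟨y, hy⟩ := hω
      have hiff : ω ∈ Z.X s ⁻¹' A ↔ y ∈ Subtype.val ⁻¹' A := by
        rw [Set.mem_preimage, Set.mem_preimage, hy]
      rw [← hy, extendZero_val]
      by_cases hyA : y ∈ Subtype.val ⁻¹' A
      · rw [Set.indicator_of_mem hyA, Set.indicator_of_mem (hiff.mpr hyA), ← hy, extendZero_val]
      · rw [Set.indicator_of_notMem hyA, Set.indicator_of_notMem (mt hiff.mp hyA)]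
    · simp [Set.indicator, extendZero_of_notMem _ hω]
  have hr : ∫ ω in Z.X s ⁻¹' A, extendZero f (Z.X (s + t) ω) ∂(Z.P x) =
      (Z.P x).real (Z.X s ⁻¹' A ∩ Z.X (s + t) ⁻¹' (Subtype.val '' B)) := by
    simp_rw [hfX]
    rw [integral_indicator_one (Z.measurable_X _ hB'),
      measureReal_restrict_apply (Z.measurable_X _ hB'), Set.inter_comm]
  rw [hl, hr] at h1
  have h2 := congrArg ENNReal.ofReal h1
  rw [ofReal_measureReal, ofReal_integral_eq_lintegral_ofReal] at h2
  · rw [← h2]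
    exact lintegral_congr fun y => by rw [ofReal_measureReal]
  · refine Integrable.of_bound hkm.aestronglyMeasurable 1 (ae_of_all _ fun y => ?_)
    rw [Real.norm_of_nonneg measureReal_nonneg]
    exact ENNReal.toReal_le_of_le_ofReal zero_le_one
      (by simpa using Z.liveKernel_univ_le t y B)
  · exact ae_of_all _ fun y => measureReal_nonneg

/-- With `A` the whole space this is Chapman–Kolmogorov. General `A` is kept for
`doobKernel_preimage_le`, where the position at the intermediate time is constrained. -/
theorem comap_restrict_eq_bind (x : Live cem) (s t : ℝ≥0) {A : Set S} (hA : MeasurableSet A) :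
    (((Z.P x).restrict (Z.X s ⁻¹' A)).map (Z.X (s + t))).comap Subtype.val =
      ((Z.liveKernel s x).restrict (Subtype.val ⁻¹' A)).bind (Z.liveKernel t) := by
  ext B hB
  have hB' := measurableEmbedding_live.measurableSet_image.mpr hB
  rw [Measure.comap_apply _ Subtype.val_injective
      (fun s hs => measurableEmbedding_live.measurableSet_image.mpr hs) _ hB,
    Measure.map_apply (Z.measurable_X _) hB', Measure.restrict_apply (Z.measurable_X _ hB'),
    Measure.bind_apply hB (Kernel.aemeasurable _), Set.inter_comm, Z.markov_two_times x s t hA hB]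

theorem liveKernel_add (x : Live cem) (s t : ℝ≥0) :
    Z.liveKernel (s + t) x = (Z.liveKernel s x).bind (Z.liveKernel t) := by
  have h := Z.comap_restrict_eq_bind x s t MeasurableSet.univ
  simpa [← liveKernel_apply] using h

theorem liveKernel_zero (x : Live cem) : Z.liveKernel 0 x = Measure.dirac x := by
  ext A hA
  rw [Z.liveKernel_apply' 0 x hA, Measure.dirac_apply' _ hA]
  have h : Z.X 0 ⁻¹' (Subtype.val '' A) =ᵐ[Z.P x] {_ω | x ∈ A} := by
    filter_upwards [Z.start x] with ω hω
    refine propext ?_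
    change Z.X 0 ω ∈ Subtype.val '' A ↔ x ∈ A
    rw [hω, Subtype.val_injective.mem_set_image]
  rw [measure_congr h]
  by_cases hx : x ∈ A <;> simp [hx]

end AbsorbedMarkovProcess

end QSD

/-! ### Stationary Markov semigroups: regularity in time and time averages. -/

namespace QSD

section General

variable {E F : Type*} [MeasurableSpace E] [MeasurableSpace F]

theorem integral_bind_kernel {μ : Measure E} {κ : Kernel E F} {f : F → ℝ}
    (hf : Integrable f (μ.bind κ)) : ∫ y, f y ∂(μ.bind κ) = ∫ x, ∫ y, f y ∂κ x ∂μ := by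
  have h := Measure.comp_eq_comp_const_apply (μ := μ) (κ := κ)
  rw [h] at hf ⊢
  rw [Kernel.integral_comp hf, Kernel.const_apply]

/-- Replacing `s` by the grid point just to its right leaves only countably many time values, so the
approximation is jointly measurable; right continuity makes it converge. -/
theorem measurable_uncurry_of_right_continuous {f : ℝ → E → ℝ} (hm : ∀ s, Measurable (f s))
    (hr : ∀ s x, ContinuousWithinAt (fun u => f u x) (Set.Ici s) s) :
    Measurable (Function.uncurry f) := by
  -- The floor plus one, rather than the floor, keeps the grid point to the right of `s`.
  let a : ℕ → ℝ → ℝ := fun n s => ((⌊((n : ℝ) + 1) * s⌋ : ℤ) + 1 : ℝ) / ((n : ℝ) + 1)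
  have ha1 : ∀ n s, s ≤ a n s := fun n s => by
    rw [le_div_iff₀ (by positivity), mul_comm]
    exact (Int.lt_floor_add_one _).le
  have ha2 : ∀ n s, a n s ≤ s + 1 / ((n : ℝ) + 1) := fun n s => by
    have : (0 : ℝ) < (n : ℝ) + 1 := by positivity
    have h2 : (s + 1 / ((n : ℝ) + 1)) * ((n : ℝ) + 1) = ((n : ℝ) + 1) * s + 1 := by
      field_simp
    rw [div_le_iff₀ this, h2]
    exact add_le_add_left (Int.floor_le _) 1
  refine measurable_of_tendsto_metrizable (f := fun n p => f (a n p.1) p.2) (fun n => ?_) ?_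
  · let G : ℤ × E → ℝ := fun q => f (((q.1 : ℝ) + 1) / ((n : ℝ) + 1)) q.2
    have hG : Measurable G := measurable_from_prod_countable_right fun k =>
      hm (((k : ℝ) + 1) / ((n : ℝ) + 1))
    have hp : Measurable fun p : ℝ × E => ((⌊((n : ℝ) + 1) * p.1⌋ : ℤ), p.2) := by fun_prop
    exact hG.comp hp
  · refine tendsto_pi_nhds.mpr fun p => ?_
    have h1 : Tendsto (fun n => a n p.1) atTop (𝓝 p.1) := by
      refine tendsto_of_tendsto_of_tendsto_of_le_of_le tendsto_const_nhds ?_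
        (fun n => ha1 n p.1) (fun n => ha2 n p.1)
      simpa using tendsto_const_nhds.add (tendsto_one_div_add_atTop_nhds_zero_nat (𝕜 := ℝ))
    exact (hr p.1 p.2).tendsto.comp (tendsto_nhdsWithin_iff.mpr
      ⟨h1, Eventually.of_forall fun n => ha1 n p.1⟩)

end General

/-- A semigroup of Markov kernels with invariant measure `β`, stochastically continuous at `0`. -/
structure StationarySemigroup {E : Type*} [TopologicalSpace E] [MeasurableSpace E]
    (Q : ℝ≥0 → Kernel E E) (β : Measure E) : Prop where
  isMarkovKernel : ∀ t, IsMarkovKernel (Q t)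
  zero : ∀ x, Q 0 x = Measure.dirac x
  add : ∀ x s t, Q (s + t) x = (Q s x).bind (Q t)
  invariant : ∀ t, β.bind (Q t) = β
  tendsto : ∀ (g : BoundedContinuousFunction E ℝ) (x : E),
    Tendsto (fun t => ∫ y, g y ∂Q t x) (𝓝[>] 0) (𝓝 (g x))

/-- The function `x ↦ Q_s g (x)`, with `s` truncated at `0`. -/
noncomputable def flow {E : Type*} [MeasurableSpace E] (Q : ℝ≥0 → Kernel E E) (g : E → ℝ)
    (s : ℝ) (x : E) : ℝ :=
  ∫ y, g y ∂Q s.toNNReal x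

/-- The function `x ↦ ∫_t^{t+h} Q_s g (x) ds`. -/
noncomputable def flowMean {E : Type*} [MeasurableSpace E] (Q : ℝ≥0 → Kernel E E) (g : E → ℝ)
    (h t : ℝ) (x : E) : ℝ :=
  ∫ s in t..(t + h), flow Q g s x

namespace StationarySemigroup

variable {E : Type*} [PseudoMetricSpace E] [MeasurableSpace E]
  {Q : ℝ≥0 → Kernel E E} {β : Measure E}

theorem abs_flow_le (hQ : StationarySemigroup Q β) (g : BoundedContinuousFunction E ℝ) (s : ℝ)
    (x : E) : |flow Q g s x| ≤ ‖g‖ := by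
  have := hQ.isMarkovKernel s.toNNReal
  have h := norm_integral_le_of_norm_le_const (μ := Q s.toNNReal x)
    (ae_of_all _ g.norm_coe_le_norm)
  simpa using! h

theorem abs_flowMean_le (hQ : StationarySemigroup Q β) (g : BoundedContinuousFunction E ℝ)
    (h t : ℝ) (x : E) : |flowMean Q g h t x| ≤ ‖g‖ * |h| := by
  have := intervalIntegral.norm_integral_le_of_norm_le_const (a := t) (b := t + h)
    (f := fun s => flow Q g s x) (fun s _ => hQ.abs_flow_le g s x)
  simpa [flowMean] using! this

variable [BorelSpace E]

theorem integrable_bcf {μ : Measure E} [IsFiniteMeasure μ]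
    (g : BoundedContinuousFunction E ℝ) : Integrable g μ :=
  .of_bound g.continuous.measurable.aestronglyMeasurable ‖g‖ (ae_of_all _ g.norm_coe_le_norm)

theorem measurable_flow (g : BoundedContinuousFunction E ℝ) (s : ℝ) :
    Measurable (flow Q g s) :=
  (g.continuous.measurable.stronglyMeasurable.integral_kernel (κ := Q s.toNNReal)).measurable

theorem flow_zero (hQ : StationarySemigroup Q β) (g : BoundedContinuousFunction E ℝ) (x : E) :
    flow Q g 0 x = g x := by
  rw [flow, Real.toNNReal_zero, hQ.zero,
    integral_dirac' _ _ g.continuous.measurable.stronglyMeasurable]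

theorem integral_flow (hQ : StationarySemigroup Q β) (g : BoundedContinuousFunction E ℝ)
    (r : ℝ≥0) {s : ℝ} (hs : 0 ≤ s) (x : E) :
    ∫ y, flow Q g s y ∂Q r x = flow Q g (r + s) x := by
  have := hQ.isMarkovKernel (r + s.toNNReal)
  have h : (r + s : ℝ).toNNReal = r + s.toNNReal := by
    rw [Real.toNNReal_add r.coe_nonneg hs, Real.toNNReal_coe]
  have hi : Integrable g ((Q r x).bind (Q s.toNNReal)) := by
    rw [← hQ.add]
    exact integrable_bcf g
  unfold flow
  rw [h, hQ.add, integral_bind_kernel hi]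

theorem integral_flow_invariant (hQ : StationarySemigroup Q β) [IsProbabilityMeasure β]
    (g : BoundedContinuousFunction E ℝ) (s : ℝ) : ∫ x, flow Q g s x ∂β = ∫ x, g x ∂β := by
  have hi : Integrable g (β.bind (Q s.toNNReal)) := by
    rw [hQ.invariant]
    exact integrable_bcf g
  conv_rhs => rw [← hQ.invariant s.toNNReal]
  rw [integral_bind_kernel hi]
  rfl

/-- Write `Q_u g = Q_t (Q_{u-t} g)` and use dominated convergence under `Q_t x`. Continuity at `0`
thus propagates from the right only: `Q_t g` need not be continuous in space, so the other
factorization is of no use. -/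
theorem tendsto_kernel_right (hQ : StationarySemigroup Q β) (g : BoundedContinuousFunction E ℝ)
    (t : ℝ≥0) (x : E) :
    Tendsto (fun u => ∫ y, g y ∂Q u x) (𝓝[>] t) (𝓝 (∫ y, g y ∂Q t x)) := by
  have := hQ.isMarkovKernel
  have h1 : Tendsto (fun u => u - t) (𝓝[>] t) (𝓝[>] 0) := by
    refine tendsto_nhdsWithin_iff.mpr ⟨?_, ?_⟩
    · have : Tendsto (fun u => u - t) (𝓝 t) (𝓝 (t - t)) :=
        (continuous_id.sub continuous_const).tendsto t
      rw [tsub_self] at this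
      exact this.mono_left nhdsWithin_le_nhds
    · exact eventually_nhdsWithin_of_forall fun u hu => Set.mem_Ioi.mpr (tsub_pos_of_lt (Set.mem_Ioi.mp hu))
  have h2 : Tendsto (fun u => ∫ y, (∫ z, g z ∂Q (u - t) y) ∂Q t x) (𝓝[>] t)
      (𝓝 (∫ y, g y ∂Q t x)) := by
    refine tendsto_integral_filter_of_dominated_convergence (fun _ => ‖g‖)
      (Eventually.of_forall fun u =>
        (g.continuous.measurable.stronglyMeasurable.integral_kernel
          (κ := Q (u - t))).aestronglyMeasurable)
      (Eventually.of_forall fun u => ae_of_all _ fun y => ?_) (integrable_const _)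
      (ae_of_all _ fun y => (hQ.tendsto g y).comp h1)
    have h := hQ.abs_flow_le g (u - t : ℝ≥0) y
    rwa [flow, Real.toNNReal_coe] at h
  refine h2.congr' (eventually_nhdsWithin_of_forall fun u hu => ?_)
  have h := hQ.integral_flow g t (u - t : ℝ≥0).2 x
  have hu' : t + (u - t) = u := add_tsub_cancel_of_le (le_of_lt hu)
  simp only [flow, NNReal.val_eq_coe, Real.toNNReal_coe, ← NNReal.coe_add, hu'] at h
  exact h

/-- Truncation at `0` is continuous and monotone, so right continuity holds at every real time and
time integrals need no case distinction on signs. -/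
theorem continuousWithinAt_flow (hQ : StationarySemigroup Q β)
    (g : BoundedContinuousFunction E ℝ) (s : ℝ) (x : E) :
    ContinuousWithinAt (fun u => flow Q g u x) (Set.Ici s) s := by
  have h : ContinuousWithinAt (fun u => ∫ y, g y ∂Q u x) (Set.Ici s.toNNReal) s.toNNReal :=
    continuousWithinAt_Ioi_iff_Ici.mp (hQ.tendsto_kernel_right g s.toNNReal x)
  exact ContinuousWithinAt.comp (f := Real.toNNReal) h
    continuous_real_toNNReal.continuousWithinAt fun u hu => Real.toNNReal_le_toNNReal hu

theorem measurable_uncurry_flow (hQ : StationarySemigroup Q β)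
    (g : BoundedContinuousFunction E ℝ) : Measurable (Function.uncurry (flow Q g)) :=
  measurable_uncurry_of_right_continuous (measurable_flow g) (hQ.continuousWithinAt_flow g)

theorem measurable_flow_time (hQ : StationarySemigroup Q β)
    (g : BoundedContinuousFunction E ℝ) (x : E) : Measurable fun s => flow Q g s x :=
  (hQ.measurable_uncurry_flow g).comp (measurable_id.prodMk measurable_const)

theorem intervalIntegrable_flow (hQ : StationarySemigroup Q β)
    (g : BoundedContinuousFunction E ℝ) (x : E) (a b : ℝ) :
    IntervalIntegrable (fun s => flow Q g s x) volume a b := by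
  rw [intervalIntegrable_iff]
  exact IntegrableOn.of_bound measure_Ioc_lt_top
    (hQ.measurable_flow_time g x).aestronglyMeasurable ‖g‖ (ae_of_all _ fun s => hQ.abs_flow_le g s x)

theorem flowMean_eq_sub (hQ : StationarySemigroup Q β) (g : BoundedContinuousFunction E ℝ)
    (h t : ℝ) (x : E) :
    flowMean Q g h t x =
      (∫ s in (0 : ℝ)..(t + h), flow Q g s x) - ∫ s in (0 : ℝ)..t, flow Q g s x :=
  (intervalIntegral.integral_interval_sub_left (hQ.intervalIntegrable_flow g x _ _)
    (hQ.intervalIntegrable_flow g x _ _)).symm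

theorem abs_integral_flow_sub_le (hQ : StationarySemigroup Q β)
    (g : BoundedContinuousFunction E ℝ) (a b : ℝ) (x : E) :
    |(∫ s in (0 : ℝ)..b, flow Q g s x) - ∫ s in (0 : ℝ)..a, flow Q g s x| ≤ ‖g‖ * |b - a| := by
  rw [intervalIntegral.integral_interval_sub_left (hQ.intervalIntegrable_flow g x _ _)
    (hQ.intervalIntegrable_flow g x _ _)]
  exact intervalIntegral.norm_integral_le_of_norm_le_const (f := fun s => flow Q g s x) (fun s _ =>
    hQ.abs_flow_le g s x)

theorem abs_flowMean_sub_le (hQ : StationarySemigroup Q β) (g : BoundedContinuousFunction E ℝ)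
    (h t u : ℝ) (x : E) :
    |flowMean Q g h u x - flowMean Q g h t x| ≤ 2 * ‖g‖ * |u - t| := by
  have h1 := hQ.abs_integral_flow_sub_le g (t + h) (u + h) x
  have h2 := hQ.abs_integral_flow_sub_le g t u x
  rw [add_sub_add_right_eq_sub] at h1
  rw [hQ.flowMean_eq_sub, hQ.flowMean_eq_sub]
  rw [abs_le] at *
  constructor <;> linarith

theorem measurable_flowMean (hQ : StationarySemigroup Q β) (g : BoundedContinuousFunction E ℝ)
    (h t : ℝ) : Measurable (flowMean Q g h t) := by
  have hm : StronglyMeasurable (Function.uncurry fun x s => flow Q g s x) :=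
    ((hQ.measurable_uncurry_flow g).comp measurable_swap).stronglyMeasurable
  unfold flowMean intervalIntegral
  exact (hm.integral_prod_right.sub hm.integral_prod_right).measurable

theorem continuous_flowMean (hQ : StationarySemigroup Q β) (g : BoundedContinuousFunction E ℝ)
    (h : ℝ) (x : E) : Continuous fun t => flowMean Q g h t x := by
  have hc : Continuous fun t => ∫ s in (0 : ℝ)..t, flow Q g s x :=
    intervalIntegral.continuous_primitive (fun a b => hQ.intervalIntegrable_flow g x a b) 0
  simp_rw [hQ.flowMean_eq_sub]
  exact (hc.comp (continuous_id.add continuous_const)).sub hc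

theorem hasDerivWithinAt_integral_flow (hQ : StationarySemigroup Q β)
    (g : BoundedContinuousFunction E ℝ) (t : ℝ) (x : E) :
    HasDerivWithinAt (fun u => ∫ s in (0 : ℝ)..u, flow Q g s x) (flow Q g t x) (Set.Ici t) t :=
  intervalIntegral.integral_hasDerivWithinAt_right (hQ.intervalIntegrable_flow g x _ _)
    (t := Set.Ioi t) (hQ.measurable_flow_time g x).stronglyMeasurable.stronglyMeasurableAtFilter
    ((hQ.continuousWithinAt_flow g t x).mono Set.Ioi_subset_Ici_self)

/-- The fundamental theorem of calculus at both endpoints; right continuity of the integrand gives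
right derivatives, at every `x` and not just almost everywhere. -/
theorem hasDerivWithinAt_flowMean (hQ : StationarySemigroup Q β)
    (g : BoundedContinuousFunction E ℝ) (h t : ℝ) (x : E) :
    HasDerivWithinAt (fun u => flowMean Q g h u x) (flow Q g (t + h) x - flow Q g t x)
      (Set.Ici t) t := by
  simp_rw [hQ.flowMean_eq_sub]
  refine HasDerivWithinAt.sub ?_ (hQ.hasDerivWithinAt_integral_flow g t x)
  have h2 : HasDerivWithinAt (fun u : ℝ => u + h) 1 (Set.Ici t) t :=
    ((hasDerivAt_id t).add_const h).hasDerivWithinAt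
  have h3 := (hQ.hasDerivWithinAt_integral_flow g (t + h) x).scomp t h2
    (fun u (hu : t ≤ u) => add_le_add_left hu h)
  simpa [Function.comp_def] using h3

/-- Fubini and the semigroup law: averaging commutes with the semigroup, `Q_r U_t = U_{t+r}`. -/
theorem integral_flowMean (hQ : StationarySemigroup Q β) (g : BoundedContinuousFunction E ℝ)
    {h : ℝ} (hh : 0 ≤ h) {t : ℝ} (ht : 0 ≤ t) (r : ℝ≥0) (x : E) :
    ∫ y, flowMean Q g h t y ∂Q r x = flowMean Q g h (r + t) x := by
  have := hQ.isMarkovKernel r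
  have hle : t ≤ t + h := by linarith
  have hint : Integrable (Function.uncurry fun y s => flow Q g s y)
      ((Q r x).prod (volume.restrict (Set.Ioc t (t + h)))) :=
    .of_bound ((hQ.measurable_uncurry_flow g).comp measurable_swap).aestronglyMeasurable ‖g‖
      (ae_of_all _ fun p => hQ.abs_flow_le g p.2 p.1)
  unfold flowMean
  simp_rw [intervalIntegral.integral_of_le hle]
  rw [integral_integral_swap hint, ← intervalIntegral.integral_of_le hle,
    add_assoc, ← intervalIntegral.integral_comp_add_left (fun s => flow Q g s x) (r : ℝ)]
  refine intervalIntegral.integral_congr fun s hs => ?_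
  rw [Set.uIcc_of_le hle] at hs
  exact hQ.integral_flow g r (ht.trans hs.1) x

theorem integral_flowMean_invariant (hQ : StationarySemigroup Q β) [IsProbabilityMeasure β]
    (g : BoundedContinuousFunction E ℝ) {h : ℝ} (hh : 0 ≤ h) (t : ℝ) :
    ∫ y, flowMean Q g h t y ∂β = h * ∫ x, g x ∂β := by
  have hle : t ≤ t + h := by linarith
  have hint : Integrable (Function.uncurry fun y s => flow Q g s y)
      (β.prod (volume.restrict (Set.Ioc t (t + h)))) :=
    .of_bound ((hQ.measurable_uncurry_flow g).comp measurable_swap).aestronglyMeasurable ‖g‖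
      (ae_of_all _ fun p => hQ.abs_flow_le g p.2 p.1)
  unfold flowMean
  simp_rw [intervalIntegral.integral_of_le hle]
  rw [integral_integral_swap hint]
  simp_rw [hQ.integral_flow_invariant g]
  simp [hh]

end StationarySemigroup

end QSD

/-! ### Energy decay for bounded continuous functions. -/

namespace QSD

namespace StationarySemigroup

variable {E : Type*} [PseudoMetricSpace E] [MeasurableSpace E] [BorelSpace E]
  {Q : ℝ≥0 → Kernel E E} {β : Measure E} [IsProbabilityMeasure β]

theorem continuous_integral_flowMean_sq (hQ : StationarySemigroup Q β)
    (g : BoundedContinuousFunction E ℝ) (h : ℝ) :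
    Continuous fun t => ∫ x, flowMean Q g h t x ^ 2 ∂β := by
  refine continuous_of_dominated (bound := fun _ => (‖g‖ * |h|) ^ 2)
    (fun t => ((hQ.measurable_flowMean g h t).pow_const 2).aestronglyMeasurable)
    (fun t => ae_of_all _ fun x => ?_) (integrable_const _)
    (ae_of_all _ fun x => (hQ.continuous_flowMean g h x).pow 2)
  rw [norm_pow]
  exact pow_le_pow_left₀ (norm_nonneg _) (hQ.abs_flowMean_le g h t x) 2

theorem integrable_flowMean_sq (hQ : StationarySemigroup Q β)
    (g : BoundedContinuousFunction E ℝ) (h t : ℝ) :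
    Integrable (fun x => flowMean Q g h t x ^ 2) β := by
  refine .of_bound ((hQ.measurable_flowMean g h t).pow_const 2).aestronglyMeasurable
    ((‖g‖ * |h|) ^ 2) (ae_of_all _ fun x => ?_)
  rw [norm_pow]
  exact pow_le_pow_left₀ (norm_nonneg _) (hQ.abs_flowMean_le g h t x) 2

/-- Differentiation under the integral: the difference quotients are dominated by a constant because
`U_t` is bounded and Lipschitz in `t`, uniformly in `x`. -/
theorem tendsto_slope_integral_flowMean_sq (hQ : StationarySemigroup Q β)
    (g : BoundedContinuousFunction E ℝ) (h t : ℝ) :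
    Tendsto (fun z => (z - t)⁻¹ *
        ((∫ x, flowMean Q g h z x ^ 2 ∂β) - ∫ x, flowMean Q g h t x ^ 2 ∂β)) (𝓝[>] t)
      (𝓝 (∫ x, 2 * (flowMean Q g h t x * (flow Q g (t + h) x - flow Q g t x)) ∂β)) := by
  have heq : ∀ z, (z - t)⁻¹ *
      ((∫ x, flowMean Q g h z x ^ 2 ∂β) - ∫ x, flowMean Q g h t x ^ 2 ∂β) =
      ∫ x, (z - t)⁻¹ * (flowMean Q g h z x ^ 2 - flowMean Q g h t x ^ 2) ∂β := fun z => by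
    rw [integral_const_mul, integral_sub (hQ.integrable_flowMean_sq g h z)
      (hQ.integrable_flowMean_sq g h t)]
  simp_rw [heq]
  refine tendsto_integral_filter_of_dominated_convergence
    (fun _ => 2 * ‖g‖ * (2 * (‖g‖ * |h|)))
    (Eventually.of_forall fun z => (((hQ.measurable_flowMean g h z).pow_const 2).sub
      ((hQ.measurable_flowMean g h t).pow_const 2)).const_mul _ |>.aestronglyMeasurable)
    (eventually_nhdsWithin_of_forall fun z hz => ae_of_all _ fun x => ?_) (integrable_const _)
    (ae_of_all _ fun x => ?_)
  · have hz' : 0 < z - t := sub_pos.mpr hz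
    have h1 := hQ.abs_flowMean_sub_le g h t z x
    have h2 := (abs_add_le _ _).trans
      (add_le_add (hQ.abs_flowMean_le g h z x) (hQ.abs_flowMean_le g h t x))
    rw [abs_of_pos hz'] at h1
    rw [norm_mul, norm_inv, Real.norm_of_nonneg hz'.le, sq_sub_sq, norm_mul, Real.norm_eq_abs,
      Real.norm_eq_abs, inv_mul_le_iff₀ hz']
    calc _ ≤ (‖g‖ * |h| + ‖g‖ * |h|) * (2 * ‖g‖ * (z - t)) := by gcongr
      _ = _ := by ring
  · have hd := (hQ.hasDerivWithinAt_flowMean g h t x).pow 2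
    rw [hasDerivWithinAt_iff_tendsto_slope, Set.Ici_sdiff_left] at hd
    simpa [slope_fun_def, mul_assoc] using hd

theorem integral_flowMean_sq_le (hQ : StationarySemigroup Q β)
    (g : BoundedContinuousFunction E ℝ) {C h : ℝ} (hC : 0 < C)
    (hP : ∀ t, 0 ≤ t → ∫ x, flowMean Q g h t x ^ 2 ∂β ≤
      -C * ∫ x, flowMean Q g h t x * (flow Q g (t + h) x - flow Q g t x) ∂β)
    {t : ℝ} (ht : 0 ≤ t) :
    ∫ x, flowMean Q g h t x ^ 2 ∂β ≤
      (∫ x, flowMean Q g h 0 x ^ 2 ∂β) * Real.exp (-(2 / C) * t) := by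
  -- The inequality `hP` times `2 / C` says that the derivative is at most `-(2 / C)` times the
  -- function. Only a right derivative is at hand, which this form of Gronwall accepts.
  have := le_gronwallBound_of_liminf_deriv_right_le (a := 0) (b := t) (ε := 0) (K := -(2 / C))
    (f := fun t => ∫ x, flowMean Q g h t x ^ 2 ∂β)
    (f' := fun t => ∫ x, 2 * (flowMean Q g h t x * (flow Q g (t + h) x - flow Q g t x)) ∂β)
    (hQ.continuous_integral_flowMean_sq g h).continuousOn
    (fun u _ r hr => ((hQ.tendsto_slope_integral_flowMean_sq g h u).eventually
      (gt_mem_nhds hr)).frequently) le_rfl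
    (fun u hu => by
      have h1 := hP u hu.1
      have h2 := mul_le_mul_of_nonneg_left h1 (by positivity : 0 ≤ 2 / C)
      have h3 : 2 / C * (-C * ∫ x, flowMean Q g h u x *
          (flow Q g (u + h) x - flow Q g u x) ∂β) =
          -(2 * ∫ x, flowMean Q g h u x * (flow Q g (u + h) x - flow Q g u x) ∂β) := by
        field_simp
      rw [h3] at h2
      rw [integral_const_mul]
      linarith) t ⟨ht, le_rfl⟩
  simpa [gronwallBound_ε0] using this

/-- By right continuity `U_t / h → Q_t g` pointwise, with the bound `‖g‖`. This removes the
regularization. -/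
theorem tendsto_integral_flowMean_sq_div (hQ : StationarySemigroup Q β)
    (g : BoundedContinuousFunction E ℝ) (t : ℝ) :
    Tendsto (fun h => (∫ x, flowMean Q g h t x ^ 2 ∂β) / h ^ 2) (𝓝[>] 0)
      (𝓝 (∫ x, flow Q g t x ^ 2 ∂β)) := by
  simp_rw [← integral_div]
  refine tendsto_integral_filter_of_dominated_convergence (fun _ => ‖g‖ ^ 2)
    (Eventually.of_forall fun h =>
      (((hQ.measurable_flowMean g h t).pow_const 2).div_const _).aestronglyMeasurable)
    (eventually_nhdsWithin_of_forall fun h hh => ae_of_all _ fun x => ?_) (integrable_const _)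
    (ae_of_all _ fun x => ?_)
  · have hh' : (0 : ℝ) < h := hh
    rw [norm_div, norm_pow, norm_pow,
      div_le_iff₀ (pow_pos (norm_pos_iff.mpr hh'.ne') 2), ← mul_pow]
    exact pow_le_pow_left₀ (norm_nonneg _) (hQ.abs_flowMean_le g h t x) 2
  · have hd := hQ.hasDerivWithinAt_integral_flow g t x
    rw [hasDerivWithinAt_iff_tendsto_slope, Set.Ici_sdiff_left] at hd
    have hs : Tendsto (fun h : ℝ => t + h) (𝓝[>] 0) (𝓝[>] t) := by
      refine tendsto_nhdsWithin_iff.mpr ⟨?_, ?_⟩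
      · have : Tendsto (fun h : ℝ => t + h) (𝓝 0) (𝓝 (t + 0)) :=
          (continuous_const.add continuous_id).tendsto 0
        rw [add_zero] at this
        exact this.mono_left nhdsWithin_le_nhds
      · exact eventually_nhdsWithin_of_forall fun h hh =>
          Set.mem_Ioi.mpr (lt_add_of_pos_right t hh)
    have h2 := ((hd.comp hs).pow 2)
    refine h2.congr fun h => ?_
    simp only [Function.comp_apply, slope, add_sub_cancel_left, vsub_eq_sub, smul_eq_mul]
    rw [hQ.flowMean_eq_sub, ← div_pow, inv_mul_eq_div]

theorem integral_flow_sq_le (hQ : StationarySemigroup Q β)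
    (g : BoundedContinuousFunction E ℝ) {C : ℝ} (hC : 0 < C)
    (hP : ∀ h t, 0 < h → 0 ≤ t → ∫ x, flowMean Q g h t x ^ 2 ∂β ≤
      -C * ∫ x, flowMean Q g h t x * (flow Q g (t + h) x - flow Q g t x) ∂β)
    {t : ℝ} (ht : 0 ≤ t) :
    ∫ x, flow Q g t x ^ 2 ∂β ≤ (∫ x, g x ^ 2 ∂β) * Real.exp (-(2 / C) * t) := by
  have h1 := hQ.tendsto_integral_flowMean_sq_div g t
  have h2 := (hQ.tendsto_integral_flowMean_sq_div g 0).mul_const (Real.exp (-(2 / C) * t))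
  simp_rw [hQ.flow_zero] at h2
  refine le_of_tendsto_of_tendsto h1 h2 (eventually_nhdsWithin_of_forall fun h hh => ?_)
  change _ / _ ≤ _ / _ * _
  rw [div_mul_eq_mul_div]
  exact div_le_div_of_nonneg_right (hQ.integral_flowMean_sq_le g hC (fun t => hP h t hh) ht)
    (sq_nonneg h)

end StationarySemigroup

end QSD

/-! ### Decay on all of `L²(β)`, and duality with the chi-square divergence. -/

namespace QSD

section LTwo

variable {E : Type*} [MeasurableSpace E] {μ : Measure E}

theorem eLpNorm_two_sq (f : E → ℝ) : eLpNorm f 2 μ ^ 2 = ∫⁻ x, ‖f x‖ₑ ^ 2 ∂μ := by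
  have h := eLpNorm_nnreal_pow_eq_lintegral (f := f) (μ := μ) (p := 2) two_ne_zero
  simp only [NNReal.coe_ofNat, ENNReal.rpow_ofNat] at h
  exact h

theorem eLpNorm_two_sq_eq_ofReal {f : E → ℝ} (hf : MemLp f 2 μ) :
    eLpNorm f 2 μ ^ 2 = ENNReal.ofReal (∫ x, f x ^ 2 ∂μ) := by
  rw [eLpNorm_two_sq, ofReal_integral_eq_lintegral_ofReal hf.integrable_sq
    (ae_of_all _ fun x => sq_nonneg _)]
  refine lintegral_congr fun x => ?_
  rw [← enorm_pow, Real.enorm_of_nonneg (sq_nonneg _)]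

theorem eLpNorm_two_eq_ofReal_sqrt {f : E → ℝ} (hf : MemLp f 2 μ) :
    eLpNorm f 2 μ = ENNReal.ofReal √(∫ x, f x ^ 2 ∂μ) := by
  have h0 : 0 ≤ ∫ x, f x ^ 2 ∂μ := integral_nonneg fun x => sq_nonneg _
  refine (ENNReal.pow_right_strictMono two_ne_zero).injective ?_
  rw [eLpNorm_two_sq_eq_ofReal hf, ← ENNReal.ofReal_pow (Real.sqrt_nonneg _), Real.sq_sqrt h0]

theorem enorm_integral_le_eLpNorm_two [IsProbabilityMeasure μ] {f : E → ℝ}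
    (hf : AEStronglyMeasurable f μ) : ‖∫ x, f x ∂μ‖ₑ ≤ eLpNorm f 2 μ := by
  refine (enorm_integral_le_lintegral_enorm f).trans ?_
  rw [← eLpNorm_one_eq_lintegral_enorm]
  exact eLpNorm_le_eLpNorm_of_exponent_le one_le_two hf

theorem eLpNorm_rnDeriv_sub_one {ν : Measure E} (hν : ν ≪ μ) :
    eLpNorm (fun x => (ν.rnDeriv μ x).toReal - 1) 2 μ = chi2 ν μ := by
  rw [chi2, if_pos hν, eLpNorm_eq_lintegral_rpow_enorm_toReal two_ne_zero (by simp)]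
  simp only [ENNReal.toReal_ofNat, ENNReal.rpow_ofNat]
  congr 1
  refine lintegral_congr fun x => ?_
  rw [← enorm_pow, Real.enorm_of_nonneg (sq_nonneg _)]

theorem memLp_rnDeriv [IsProbabilityMeasure μ] {ν : Measure E} [IsProbabilityMeasure ν] (hν : ν ≪ μ)
    (hχ : chi2 ν μ ≠ ⊤) : MemLp (fun x => (ν.rnDeriv μ x).toReal) 2 μ := by
  have h1 : MemLp (fun x => (ν.rnDeriv μ x).toReal - 1) 2 μ :=
    ⟨((Measure.measurable_rnDeriv ν μ).ennreal_toReal.sub_const 1).aestronglyMeasurable, by rw [eLpNorm_rnDeriv_sub_one hν]; exact hχ.lt_top⟩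
  refine (h1.add (memLp_const 1)).congr_norm
    (Measure.measurable_rnDeriv ν μ).ennreal_toReal.aestronglyMeasurable (ae_of_all _ fun x => ?_)
  simp

end LTwo

namespace StationarySemigroup

variable {E : Type*} [PseudoMetricSpace E] [MeasurableSpace E]
  {Q : ℝ≥0 → Kernel E E} {β : Measure E}

/-- Jensen for each `Q_t x`, then invariance of `β`. -/
theorem eLpNorm_integral_le (hQ : StationarySemigroup Q β) {f : E → ℝ} (hf : Measurable f)
    (t : ℝ≥0) : eLpNorm (fun x => ∫ y, f y ∂Q t x) 2 β ≤ eLpNorm f 2 β := by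
  have := hQ.isMarkovKernel t
  have h1 : ∫⁻ y, ‖f y‖ₑ ^ 2 ∂β = ∫⁻ x, ∫⁻ y, ‖f y‖ₑ ^ 2 ∂Q t x ∂β := by
    conv_lhs => rw [← hQ.invariant t]
    exact Measure.lintegral_bind (Kernel.aemeasurable _) (hf.enorm.pow_const 2).aemeasurable
  rw [← ENNReal.pow_le_pow_left_iff two_ne_zero, eLpNorm_two_sq, eLpNorm_two_sq, h1]
  refine lintegral_mono fun x => ?_
  rw [← eLpNorm_two_sq]
  gcongr
  exact enorm_integral_le_eLpNorm_two hf.aestronglyMeasurable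

theorem ae_integrable (hQ : StationarySemigroup Q β) {f : E → ℝ} (hf : Integrable f β)
    (t : ℝ≥0) : ∀ᵐ x ∂β, Integrable f (Q t x) := by
  rw [← hQ.invariant t] at hf
  exact Measure.ae_integrable_of_integrable_comp hf

theorem integral_integral (hQ : StationarySemigroup Q β) {f : E → ℝ} (hf : Integrable f β)
    (t : ℝ≥0) : ∫ x, ∫ y, f y ∂Q t x ∂β = ∫ x, f x ∂β := by
  have h := hf
  rw [← hQ.invariant t] at h
  rw [← integral_bind_kernel h, hQ.invariant]

theorem memLp_integral (hQ : StationarySemigroup Q β) {f : E → ℝ} (hf : Measurable f)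
    (hLp : MemLp f 2 β) (t : ℝ≥0) : MemLp (fun x => ∫ y, f y ∂Q t x) 2 β :=
  have := hQ.isMarkovKernel t
  ⟨(hf.stronglyMeasurable.integral_kernel (κ := Q t)).aestronglyMeasurable,
    (hQ.eLpNorm_integral_le hf t).trans_lt hLp.2⟩

variable [IsProbabilityMeasure β]

/-- Both the density of `ν` and `Q_t |f|` lie in `L²(β)`, so their product is integrable. -/
theorem integrable_bind (hQ : StationarySemigroup Q β) {ν : Measure E} [IsProbabilityMeasure ν]
    (hν : ν ≪ β) (hχ : chi2 ν β ≠ ⊤) {f : E → ℝ} (hf : Measurable f) (hLp : MemLp f 2 β)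
    (t : ℝ≥0) : Integrable f (ν.bind (Q t)) := by
  rw [Measure.integrable_comp_iff hf.aestronglyMeasurable]
  refine ⟨hν.ae_le (hQ.ae_integrable (hLp.integrable one_le_two) t), ?_⟩
  rw [← integrable_rnDeriv_smul_iff hν]
  exact (memLp_rnDeriv hν hχ).integrable_mul (hQ.memLp_integral hf.norm hLp.norm t)

variable [BorelSpace E]

theorem eLpNorm_bcf_le (hQ : StationarySemigroup Q β) {C : ℝ} (hC : 0 < C)
    (hP : ∀ g : BoundedContinuousFunction E ℝ, ∫ x, g x ∂β = 0 → ∀ h t, 0 < h → 0 ≤ t →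
      ∫ x, flowMean Q g h t x ^ 2 ∂β ≤
        -C * ∫ x, flowMean Q g h t x * (flow Q g (t + h) x - flow Q g t x) ∂β)
    (g : BoundedContinuousFunction E ℝ) (t : ℝ≥0) :
    eLpNorm (fun x => (∫ y, g y ∂Q t x) - ∫ y, g y ∂β) 2 β ≤
      ENNReal.ofReal (Real.exp (-(t : ℝ) / C)) * eLpNorm g 2 β := by
  have := hQ.isMarkovKernel t
  set c := ∫ y, g y ∂β with hc
  let g0 : BoundedContinuousFunction E ℝ := g - BoundedContinuousFunction.const E c
  have hg0 : ∀ x, g0 x = g x - c := fun x => rfl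
  have hg0m : ∫ x, g0 x ∂β = 0 := by
    simp_rw [hg0]
    rw [integral_sub (integrable_bcf g) (integrable_const _)]
    simp [hc]
  have hfl : ∀ x, (∫ y, g y ∂Q t x) - c = flow Q g0 t x := fun x => by
    rw [flow, Real.toNNReal_coe]
    simp_rw [hg0]
    rw [integral_sub (integrable_bcf g) (integrable_const _)]
    simp
  have hLp : ∀ g : BoundedContinuousFunction E ℝ, MemLp g 2 β := fun g =>
    .of_bound g.continuous.measurable.aestronglyMeasurable ‖g‖ (ae_of_all _ g.norm_coe_le_norm)
  have hfLp : MemLp (flow Q g0 t) 2 β :=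
    .of_bound (measurable_flow g0 t).aestronglyMeasurable ‖g0‖
      (ae_of_all _ (hQ.abs_flow_le g0 t))
  have hle := hQ.integral_flow_sq_le g0 hC (hP g0 hg0m) t.coe_nonneg
  -- The variance is at most the second moment, so the final bound involves the uncentred norm.
  have hvar : ∫ x, g0 x ^ 2 ∂β ≤ ∫ x, g x ^ 2 ∂β := by
    have h1 : ∀ x, g0 x ^ 2 = g x ^ 2 - (2 * c * g x - c ^ 2) := fun x => by rw [hg0]; ring
    simp_rw [h1]
    have h2 : Integrable (fun x => 2 * c * g x) β := (integrable_bcf g).const_mul _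
    have h3 : Integrable (fun x => 2 * c * g x - c ^ 2) β := h2.sub (integrable_const _)
    rw [integral_sub (hLp g).integrable_sq h3,
      integral_sub h2 (integrable_const _), integral_const_mul, ← hc]
    simp only [integral_const, probReal_univ, one_smul]
    nlinarith [sq_nonneg c]
  simp_rw [hfl]
  rw [← ENNReal.pow_le_pow_left_iff two_ne_zero, mul_pow, eLpNorm_two_sq_eq_ofReal hfLp,
    eLpNorm_two_sq_eq_ofReal (hLp g), ← ENNReal.ofReal_pow (Real.exp_pos _).le,
    ← ENNReal.ofReal_mul (by positivity)]
  refine ENNReal.ofReal_le_ofReal (hle.trans ?_)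
  have hexp : Real.exp (-(t : ℝ) / C) ^ 2 = Real.exp (-(2 / C) * t) := by
    rw [← Real.exp_nat_mul]
    congr 1
    push_cast
    ring
  rw [hexp, mul_comm]
  gcongr

theorem eLpNorm_decay (hQ : StationarySemigroup Q β) {C : ℝ} (hC : 0 < C)
    (hP : ∀ g : BoundedContinuousFunction E ℝ, ∫ x, g x ∂β = 0 → ∀ h t, 0 < h → 0 ≤ t →
      ∫ x, flowMean Q g h t x ^ 2 ∂β ≤
        -C * ∫ x, flowMean Q g h t x * (flow Q g (t + h) x - flow Q g t x) ∂β)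
    {f : E → ℝ} (hf : Measurable f) (hLp : MemLp f 2 β) (t : ℝ≥0) :
    eLpNorm (fun x => (∫ y, f y ∂Q t x) - ∫ y, f y ∂β) 2 β ≤
      ENNReal.ofReal (Real.exp (-(t : ℝ) / C)) * eLpNorm f 2 β := by
  have := hQ.isMarkovKernel t
  refine ENNReal.le_of_forall_pos_le_add fun ε hε _ => ?_
  -- The three thirds pay for `Q_t (f - g)`, for the mean of `f - g`, and for replacing the norm of
  -- `g` by that of `f`.
  have hε3 : (ε : ℝ≥0∞) / 3 ≠ 0 := by simp [hε.ne']
  obtain ⟨g, hg, hgLp⟩ := hLp.exists_boundedContinuous_eLpNorm_sub_le (by simp) hε3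
  have hgm : Measurable g := g.continuous.measurable
  have hfi : Integrable f β := hLp.integrable one_le_two
  have hdi : Integrable (f - (g : E → ℝ)) β := hfi.sub (integrable_bcf g)
  have hdm : Measurable (f - (g : E → ℝ)) := hf.sub hgm
  have hkm : ∀ {u : E → ℝ}, Measurable u → AEStronglyMeasurable (fun x => ∫ y, u y ∂Q t x) β :=
    fun hu => (hu.stronglyMeasurable.integral_kernel (κ := Q t)).aestronglyMeasurable
  have hae : (fun x => (∫ y, f y ∂Q t x) - ∫ y, f y ∂β) =ᵐ[β]
      ((fun x => ∫ y, (f - ⇑g) y ∂Q t x) + fun x => (∫ y, g y ∂Q t x) - ∫ y, g y ∂β) +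
        fun _ => -∫ y, (f - ⇑g) y ∂β := by
    filter_upwards [hQ.ae_integrable hfi t] with x hx
    simp only [Pi.add_apply, Pi.sub_apply]
    rw [integral_sub hx (integrable_bcf g), integral_sub hfi (integrable_bcf g)]
    ring
  have hexp : ENNReal.ofReal (Real.exp (-(t : ℝ) / C)) ≤ 1 := by
    rw [ENNReal.ofReal_le_one, Real.exp_le_one_iff]
    exact div_nonpos_of_nonpos_of_nonneg (by simp) hC.le
  have hgf : eLpNorm g 2 β ≤ eLpNorm f 2 β + ε / 3 := by
    have h : (g : E → ℝ) = f - (f - ⇑g) := by simp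
    calc eLpNorm g 2 β = eLpNorm (f - (f - ⇑g)) 2 β := by rw [← h]
      _ ≤ eLpNorm f 2 β + eLpNorm (f - ⇑g) 2 β :=
        eLpNorm_sub_le hf.aestronglyMeasurable hdm.aestronglyMeasurable one_le_two
      _ ≤ _ := by gcongr
  have hc : eLpNorm (fun _ : E => -∫ y, (f - ⇑g) y ∂β) 2 β ≤ ε / 3 := by
    rw [eLpNorm_const _ two_ne_zero (IsProbabilityMeasure.ne_zero β)]
    simp only [enorm_neg, measure_univ, ENNReal.one_rpow, mul_one]
    exact (enorm_integral_le_eLpNorm_two hdm.aestronglyMeasurable).trans hg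
  rw [eLpNorm_congr_ae hae]
  have hm2 : AEStronglyMeasurable (fun x => (∫ y, g y ∂Q t x) - ∫ y, g y ∂β) β :=
    (hkm hgm).sub aestronglyMeasurable_const
  calc _ ≤ eLpNorm (fun x => ∫ y, (f - ⇑g) y ∂Q t x) 2 β +
          eLpNorm (fun x => (∫ y, g y ∂Q t x) - ∫ y, g y ∂β) 2 β +
          eLpNorm (fun _ : E => -∫ y, (f - ⇑g) y ∂β) 2 β :=
        (eLpNorm_add_le ((hkm hdm).add hm2) aestronglyMeasurable_const one_le_two).trans
          (add_le_add_left (eLpNorm_add_le (hkm hdm) hm2 one_le_two) _)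
    _ ≤ ε / 3 + ENNReal.ofReal (Real.exp (-(t : ℝ) / C)) * (eLpNorm f 2 β + ε / 3) + ε / 3 := by
        gcongr
        · exact (hQ.eLpNorm_integral_le hdm t).trans hg
        · exact (hQ.eLpNorm_bcf_le hC hP g t).trans (by gcongr)
    _ ≤ ε / 3 + (ENNReal.ofReal (Real.exp (-(t : ℝ) / C)) * eLpNorm f 2 β + ε / 3) + ε / 3 := by
        rw [mul_add]
        gcongr
        exact mul_le_of_le_one_left zero_le hexp
    _ = ENNReal.ofReal (Real.exp (-(t : ℝ) / C)) * eLpNorm f 2 β + (ε / 3 + ε / 3 + ε / 3) := by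
        ring
    _ = _ := by rw [ENNReal.add_thirds]

/-- Both `dν/dβ - 1` and `Q_t f - β(f)` have `β`-mean zero, so the difference equals the integral of
their product; Cauchy–Schwarz and the `L²` decay finish. -/
theorem enorm_integral_bind_sub_le (hQ : StationarySemigroup Q β) {C : ℝ} (hC : 0 < C)
    (hP : ∀ g : BoundedContinuousFunction E ℝ, ∫ x, g x ∂β = 0 → ∀ h t, 0 < h → 0 ≤ t →
      ∫ x, flowMean Q g h t x ^ 2 ∂β ≤
        -C * ∫ x, flowMean Q g h t x * (flow Q g (t + h) x - flow Q g t x) ∂β)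
    {ν : Measure E} [IsProbabilityMeasure ν]
    (hν : ν ≪ β) (hχ : chi2 ν β ≠ ⊤) {f : E → ℝ} (hf : Measurable f) (hLp : MemLp f 2 β)
    (t : ℝ≥0) :
    ‖(∫ x, f x ∂(ν.bind (Q t))) - ∫ x, f x ∂β‖ₑ ≤
      chi2 ν β * (ENNReal.ofReal (Real.exp (-(t : ℝ) / C)) * eLpNorm f 2 β) := by
  have hfi : Integrable f β := hLp.integrable one_le_two
  have hr := memLp_rnDeriv hν hχ
  have hq := hQ.memLp_integral hf hLp t
  have hr1 : MemLp (fun x => (ν.rnDeriv β x).toReal - 1) 2 β := hr.sub (memLp_const 1)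
  set c := ∫ x, f x ∂β with hc
  have hq1 : MemLp (fun x => (∫ y, f y ∂Q t x) - c) 2 β := hq.sub (memLp_const c)
  have hri : Integrable (fun x => (ν.rnDeriv β x).toReal) β := hr.integrable one_le_two
  have h1 : (∫ x, f x ∂(ν.bind (Q t))) - c =
      ∫ x, ((ν.rnDeriv β x).toReal - 1) * ((∫ y, f y ∂Q t x) - c) ∂β := by
    have e : ∀ x, ((ν.rnDeriv β x).toReal - 1) * ((∫ y, f y ∂Q t x) - c) =
        ((ν.rnDeriv β x).toReal * (∫ y, f y ∂Q t x) - ∫ y, f y ∂Q t x) -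
          (c * (ν.rnDeriv β x).toReal - c) := fun x => by ring
    have hrq : Integrable (fun x => (ν.rnDeriv β x).toReal * ∫ y, f y ∂Q t x) β :=
      hr.integrable_mul hq
    have hqi : Integrable (fun x => ∫ y, f y ∂Q t x) β := hq.integrable one_le_two
    have hd1 : Integrable (fun x => (ν.rnDeriv β x).toReal * (∫ y, f y ∂Q t x) -
        ∫ y, f y ∂Q t x) β := hrq.sub hqi
    have hd2 : Integrable (fun x => c * (ν.rnDeriv β x).toReal - c) β :=
      (hri.const_mul c).sub (integrable_const c)
    simp_rw [e]
    rw [integral_sub hd1 hd2,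
      integral_sub hrq hqi, integral_sub (hri.const_mul c) (integrable_const c),
      integral_const_mul, Measure.integral_toReal_rnDeriv hν, hQ.integral_integral hfi t,
      integral_bind_kernel (hQ.integrable_bind hν hχ hf hLp t)]
    simp_rw [← smul_eq_mul (ν.rnDeriv β _).toReal]
    rw [integral_rnDeriv_smul hν]
    simp [hc]
  rw [h1]
  refine (enorm_integral_le_lintegral_enorm _).trans ?_
  rw [← eLpNorm_one_eq_lintegral_enorm]
  refine (eLpNorm_smul_le_mul_eLpNorm (p := 2) (q := 2) (r := 1) hq1.1 hr1.1).trans ?_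
  rw [eLpNorm_rnDeriv_sub_one hν]
  gcongr
  exact hQ.eLpNorm_decay hC hP hf hLp t

end StationarySemigroup

end QSD

/-! ### Wasserstein distance and weighted total variation. -/

namespace QSD

/-- If `∫ f dν₁ - ∫ f dν₂ ≤ D` for all `|f| ≤ ψ`, where `dist · x₀ ≤ ψ`, then `W₁(ν₁, ν₂) ≤ D`:
couple the common part of the two measures on the diagonal and the remainders independently. -/
theorem wasserstein1_le_of_abs_le {F : Type*} [MetricSpace F] [MeasurableSpace F]
    {ν₁ ν₂ : Measure F} [IsProbabilityMeasure ν₁] [IsProbabilityMeasure ν₂] {ψ : F → ℝ} {x₀ : F}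
    (hψ : Measurable ψ) (hdist : ∀ x, dist x x₀ ≤ ψ x) (h₁ : Integrable ψ ν₁)
    (h₂ : Integrable ψ ν₂) {D : ℝ}
    (hD : ∀ f : F → ℝ, Measurable f → (∀ x, |f x| ≤ ψ x) → ∫ x, f x ∂ν₁ - ∫ x, f x ∂ν₂ ≤ D) :
    wasserstein1 ν₁ ν₂ ≤ ENNReal.ofReal D := by
  have hψ0 : ∀ x, 0 ≤ ψ x := fun x => dist_nonneg.trans (hdist x)
  obtain ⟨s, hs, hs1, hs2⟩ := hahn_decomposition ν₁ ν₂
  have hle1 : ν₂.restrict s ≤ ν₁.restrict s := Measure.le_iff.mpr fun t ht => by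
    rw [Measure.restrict_apply ht, Measure.restrict_apply ht]
    exact hs1 _ (ht.inter hs) Set.inter_subset_right
  have hle2 : ν₁.restrict sᶜ ≤ ν₂.restrict sᶜ := Measure.le_iff.mpr fun t ht => by
    rw [Measure.restrict_apply ht, Measure.restrict_apply ht]
    exact hs2 _ (ht.inter hs.compl) Set.inter_subset_right
  set p := ν₁.restrict s - ν₂.restrict s with hp
  set n := ν₂.restrict sᶜ - ν₁.restrict sᶜ with hn
  -- `m` is the minimum of the two measures; `p` and `n` are the excesses of `ν₁` and `ν₂` over it,
  -- of equal mass `k`.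
  set m := ν₂.restrict s + ν₁.restrict sᶜ with hm
  have hp1 : p + ν₂.restrict s = ν₁.restrict s := Measure.sub_add_cancel_of_le hle1
  have hn1 : n + ν₁.restrict sᶜ = ν₂.restrict sᶜ := Measure.sub_add_cancel_of_le hle2
  have hν₁ : m + p = ν₁ := by
    rw [← Measure.restrict_add_restrict_compl (μ := ν₁) hs, ← hp1, hm]
    abel
  have hν₂ : m + n = ν₂ := by
    rw [← Measure.restrict_add_restrict_compl (μ := ν₂) hs, ← hn1, hm]
    abel
  have hpf : IsFiniteMeasure p := by
    refine ⟨lt_of_le_of_lt ?_ (measure_lt_top ν₁ Set.univ)⟩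
    conv_rhs => rw [← hν₁]
    simp
  have hnf : IsFiniteMeasure n := by
    refine ⟨lt_of_le_of_lt ?_ (measure_lt_top ν₂ Set.univ)⟩
    conv_rhs => rw [← hν₂]
    simp
  have hpn : n Set.univ = p Set.univ := by
    have e1 : m Set.univ + p Set.univ = 1 := by
      rw [← Measure.add_apply, hν₁, measure_univ]
    have e2 : m Set.univ + n Set.univ = 1 := by
      rw [← Measure.add_apply, hν₂, measure_univ]
    exact (ENNReal.add_right_inj (ne_top_of_le_ne_top ENNReal.one_ne_top
      (le_self_add.trans_eq e1))).mp (e2.trans e1.symm)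
  set k := p Set.univ with hk
  -- When `k = 0` the inverse is infinite, but then the remainders vanish.
  have hkp : ∀ q : Measure F, q Set.univ = k → k⁻¹ • k • q = q := fun q hq => by
    rcases eq_or_ne k 0 with h0 | h0
    · rw [h0] at hq
      rw [Measure.measure_univ_eq_zero.mp hq, smul_zero, smul_zero]
    · rw [smul_smul, ENNReal.inv_mul_cancel h0 (measure_ne_top p _), one_smul]
  set π : Measure (F × F) := m.map (fun x => (x, x)) + k⁻¹ • p.prod n with hπ
  have hπ1 : π.fst = ν₁ := by
    rw [hπ, Measure.fst_add, Measure.fst_map_prodMk (Y := fun x => x) measurable_id,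
      Measure.map_id', Measure.fst, Measure.map_smul, Measure.map_fst_prod, hpn, hkp p hk.symm,
      hν₁]
  have hπ2 : π.snd = ν₂ := by
    rw [hπ, Measure.snd_add, Measure.snd_map_prodMk (X := fun x => x) measurable_id,
      Measure.map_id', Measure.snd, Measure.map_smul, Measure.map_snd_prod, ← hk, hkp n hpn, hν₂]
  -- Only an inequality is used: without separability the distance need not be measurable for the
  -- product sigma-algebra.
  have hdiag : ∫⁻ q, edist q.1 q.2 ∂(m.map fun x => (x, x)) ≤ 0 :=
    (lintegral_map_le (fun q : F × F => edist q.1 q.2) _).trans (by simp)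
  set φ : F → ℝ≥0∞ := fun x => ENNReal.ofReal (ψ x) with hφ
  have hφm : Measurable φ := hψ.ennreal_ofReal
  have hprod : ∫⁻ q, edist q.1 q.2 ∂(p.prod n) ≤ k * (∫⁻ x, φ x ∂p + ∫⁻ x, φ x ∂n) := by
    have h1 : ∫⁻ q, φ q.1 ∂(p.prod n) = k * ∫⁻ x, φ x ∂p := by
      rw [← lintegral_map hφm measurable_fst, Measure.map_fst_prod, lintegral_smul_measure, hpn,
        smul_eq_mul]
    have h2 : ∫⁻ q, φ q.2 ∂(p.prod n) = k * ∫⁻ x, φ x ∂n := by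
      rw [← lintegral_map hφm measurable_snd, Measure.map_snd_prod, lintegral_smul_measure,
        smul_eq_mul]
    have hm1 : Measurable fun q : F × F => φ q.1 := hφm.comp measurable_fst
    rw [mul_add, ← h1, ← h2, ← lintegral_add_left hm1]
    refine lintegral_mono fun q => (edist_triangle_right _ _ x₀).trans (add_le_add ?_ ?_)
    · rw [edist_dist]
      exact ENNReal.ofReal_le_ofReal (hdist _)
    · rw [edist_dist]
      exact ENNReal.ofReal_le_ofReal (hdist _)
  have hcost : ∫⁻ q, edist q.1 q.2 ∂π ≤ ∫⁻ x, φ x ∂p + ∫⁻ x, φ x ∂n := by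
    rw [hπ, lintegral_add_measure, lintegral_smul_measure, smul_eq_mul]
    calc _ ≤ 0 + k⁻¹ * (k * (∫⁻ x, φ x ∂p + ∫⁻ x, φ x ∂n)) := by gcongr
      _ = (k⁻¹ * k) * (∫⁻ x, φ x ∂p + ∫⁻ x, φ x ∂n) := by rw [zero_add, mul_assoc]
      _ ≤ _ := mul_le_of_le_one_left zero_le (ENNReal.inv_mul_le_one k)
  have hip : Integrable ψ p := h₁.mono_measure (by rw [← hν₁]; exact Measure.le_add_left le_rfl)
  have hin : Integrable ψ n := h₂.mono_measure (by rw [← hν₂]; exact Measure.le_add_left le_rfl)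
  have hval : ∫ x, ψ x ∂p + ∫ x, ψ x ∂n ≤ D := by
    have e1 : ∫ x, ψ x ∂p + ∫ x in s, ψ x ∂ν₂ = ∫ x in s, ψ x ∂ν₁ := by
      rw [← integral_add_measure hip h₂.restrict, hp1]
    have e2 : ∫ x, ψ x ∂n + ∫ x in sᶜ, ψ x ∂ν₁ = ∫ x in sᶜ, ψ x ∂ν₂ := by
      rw [← integral_add_measure hin h₁.restrict, hn1]
    have e3 : ∀ ν : Measure F, Integrable ψ ν →
        ∫ x, s.indicator ψ x - sᶜ.indicator ψ x ∂ν = ∫ x in s, ψ x ∂ν - ∫ x in sᶜ, ψ x ∂ν :=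
      fun ν hν => by
        rw [integral_sub (hν.indicator hs) (hν.indicator hs.compl), integral_indicator hs,
          integral_indicator hs.compl]
    -- The extremal test function, `ψ` on the Hahn set and `-ψ` off it, turns the hypothesis into a
    -- bound on the total `ψ`-mass of the excesses.
    have h := hD (fun x => s.indicator ψ x - sᶜ.indicator ψ x)
      ((hψ.indicator hs).sub (hψ.indicator hs.compl)) fun x => by
        by_cases hx : x ∈ s <;> simp [hx, abs_of_nonneg (hψ0 x)]
    rw [e3 _ h₁, e3 _ h₂] at h
    linarith
  unfold wasserstein1
  refine (iInf₂_le_of_le π hπ1 (iInf_le_of_le hπ2 le_rfl)).trans (hcost.trans ?_)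
  rw [hφ, ← ofReal_integral_eq_lintegral_ofReal hip (ae_of_all _ hψ0),
    ← ofReal_integral_eq_lintegral_ofReal hin (ae_of_all _ hψ0),
    ← ENNReal.ofReal_add (integral_nonneg hψ0) (integral_nonneg hψ0)]
  exact ENNReal.ofReal_le_ofReal hval

end QSD

/-! ### The Doob transform as a stationary semigroup. -/

namespace QSD

namespace AbsorbedMarkovProcess

variable {S Ω : Type*} [MetricSpace S] [MeasurableSpace S] [BorelSpace S] [MeasurableSpace Ω]
  {cem : S} (Z : AbsorbedMarkovProcess S Ω cem)

/-- The Doob transform of the sub-Markovian semigroup by the eigenfunction `η`. -/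
noncomputable def doobKernel (η : Live cem → ℝ) (lam : ℝ) (t : ℝ≥0) : Kernel (Live cem) (Live cem) :=
  (Z.liveKernel t).withDensity fun x y => ENNReal.ofReal (Real.exp (lam * t) / η x * η y)

variable {Z} {α : Measure (Live cem)} {η : Live cem → ℝ} {lam C : ℝ} {ψ : Live cem → ℝ}

namespace PoincareAssumptions

variable (h : Z.PoincareAssumptions α η lam C ψ)
include h

theorem measurable_doob_density (c : ℝ) :
    Measurable (Function.uncurry fun x y => ENNReal.ofReal (c / η x * η y)) := by
  have := h.measurable_eta
  unfold Function.uncurry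
  fun_prop

theorem lintegral_doobKernel (t : ℝ≥0) (x : Live cem) {f : Live cem → ℝ≥0∞}
    (hf : Measurable f) :
    ∫⁻ y, f y ∂Z.doobKernel η lam t x =
      ∫⁻ y, ENNReal.ofReal (Real.exp (lam * t) / η x * η y) * f y ∂Z.liveKernel t x :=
  Kernel.lintegral_withDensity _ (h.measurable_doob_density _) x hf

theorem integral_doobKernel (t : ℝ≥0) (x : Live cem) (f : Live cem → ℝ) :
    ∫ y, f y ∂Z.doobKernel η lam t x =
      Real.exp (lam * t) / η x * ∫ y, f y * η y ∂Z.liveKernel t x := by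
  have hm : Measurable (Function.uncurry fun x y => (Real.exp (lam * t) / η x * η y).toNNReal) := by
    have := h.measurable_eta
    unfold Function.uncurry
    fun_prop
  have := Kernel.integral_withDensity (κ := Z.liveKernel t) (f := f) (a := x) hm
  refine this.trans ?_
  rw [← integral_const_mul]
  refine integral_congr_ae (ae_of_all _ fun y => ?_)
  have h0 : 0 ≤ Real.exp (lam * t) / η x * η y :=
    mul_nonneg (div_nonneg (Real.exp_pos _).le (h.eta_pos x).le) (h.eta_pos y).le
  simp only [NNReal.smul_def, Real.coe_toNNReal _ h0, smul_eq_mul]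
  ring

theorem lintegral_eta (t : ℝ≥0) (x : Live cem) :
    ∫⁻ y, ENNReal.ofReal (η y) ∂Z.liveKernel t x =
      ENNReal.ofReal (Real.exp (-lam * t) * η x) := by
  have hi := (Z.integrable_extendZero_X_iff t x h.measurable_eta).mp (h.eigenfunction t x).1
  rw [← ofReal_integral_eq_lintegral_ofReal hi (ae_of_all _ fun y => (h.eta_pos y).le),
    ← Z.semigroup_eq t x h.measurable_eta, (h.eigenfunction t x).2]

theorem lintegral_const_mul_eta {c : ℝ} (hc : 0 ≤ c) (t : ℝ≥0) (x : Live cem) :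
    ∫⁻ y, ENNReal.ofReal (c * η y) ∂Z.liveKernel t x =
      ENNReal.ofReal (c * Real.exp (-lam * t) * η x) := by
  simp_rw [ENNReal.ofReal_mul hc]
  rw [lintegral_const_mul _ h.measurable_eta.ennreal_ofReal, h.lintegral_eta,
    ← ENNReal.ofReal_mul hc, mul_assoc]

theorem isMarkovKernel_doobKernel (t : ℝ≥0) : IsMarkovKernel (Z.doobKernel η lam t) := by
  refine ⟨fun x => ⟨?_⟩⟩
  have hx := h.eta_pos x
  rw [← lintegral_one, h.lintegral_doobKernel t x measurable_const]
  simp only [mul_one]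
  rw [h.lintegral_const_mul_eta (by positivity), ← ENNReal.ofReal_one]
  congr 1
  field_simp
  rw [← Real.exp_add]
  simp

theorem doobKernel_zero (x : Live cem) : Z.doobKernel η lam 0 x = Measure.dirac x := by
  refine Measure.ext_of_lintegral _ fun f hf => ?_
  have := h.measurable_eta
  rw [h.lintegral_doobKernel 0 x hf, Z.liveKernel_zero, lintegral_dirac' _ (by fun_prop),
    lintegral_dirac' _ hf]
  simp [(h.eta_pos x).ne']

theorem doobKernel_add (x : Live cem) (s t : ℝ≥0) :
    Z.doobKernel η lam (s + t) x = (Z.doobKernel η lam s x).bind (Z.doobKernel η lam t) := by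
  refine Measure.ext_of_lintegral _ fun f hf => ?_
  have hη := h.measurable_eta
  rw [h.lintegral_doobKernel _ x hf, Measure.lintegral_bind (Kernel.aemeasurable _) hf.aemeasurable,
    h.lintegral_doobKernel s x hf.lintegral_kernel, Z.liveKernel_add,
    Measure.lintegral_bind (Kernel.aemeasurable _)
      (Measurable.aemeasurable (by fun_prop))]
  refine lintegral_congr fun y => ?_
  rw [h.lintegral_doobKernel t y hf, ← lintegral_const_mul _ (by fun_prop)]
  refine lintegral_congr fun z => ?_
  have hx := h.eta_pos x
  have hy := h.eta_pos y
  rw [← mul_assoc, ← ENNReal.ofReal_mul (by positivity)]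
  congr 2
  rw [NNReal.coe_add, mul_add, Real.exp_add]
  field_simp

theorem lintegral_eta_alpha : ∫⁻ x, ENNReal.ofReal (η x) ∂α = 1 := by
  rw [← ofReal_integral_eq_lintegral_ofReal h.integrable_eta
    (ae_of_all _ fun x => (h.eta_pos x).le), h.integral_eta, ENNReal.ofReal_one]

theorem weighted_eq : weighted η α = α.withDensity fun x => ENNReal.ofReal (η x) := by
  rw [weighted, h.lintegral_eta_alpha, inv_one, one_smul]

theorem isProbabilityMeasure_weighted : IsProbabilityMeasure (weighted η α) :=
  ⟨by rw [h.weighted_eq, withDensity_apply _ .univ, setLIntegral_univ, h.lintegral_eta_alpha]⟩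

/-- The factor `η(x)` of `β` cancels the denominator, leaving `e^{λ₀t} αP_t(ηf)`, which is `α(ηf)`
by quasi-stationarity. -/
theorem doobKernel_invariant (t : ℝ≥0) :
    (weighted η α).bind (Z.doobKernel η lam t) = weighted η α := by
  refine Measure.ext_of_lintegral _ fun f hf => ?_
  have hη := h.measurable_eta
  have hηm : Measurable fun x => ENNReal.ofReal (η x) := hη.ennreal_ofReal
  rw [Measure.lintegral_bind (Kernel.aemeasurable _) hf.aemeasurable, h.weighted_eq,
    lintegral_withDensity_eq_lintegral_mul _ hηm hf.lintegral_kernel,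
    lintegral_withDensity_eq_lintegral_mul _ hηm hf]
  have h1 : ∀ x, ((fun x => ENNReal.ofReal (η x)) *
      fun x => ∫⁻ y, f y ∂Z.doobKernel η lam t x) x =
      ∫⁻ y, ENNReal.ofReal (Real.exp (lam * t)) * (ENNReal.ofReal (η y) * f y)
        ∂Z.liveKernel t x := fun x => by
    have hx := h.eta_pos x
    rw [Pi.mul_apply, h.lintegral_doobKernel t x hf, ← lintegral_const_mul _ (by fun_prop)]
    refine lintegral_congr fun y => ?_
    rw [← mul_assoc, ← mul_assoc, ← ENNReal.ofReal_mul hx.le,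
      ← ENNReal.ofReal_mul (Real.exp_pos _).le]
    congr 2
    field_simp
  simp_rw [h1]
  rw [← Measure.lintegral_bind (m := α) (f := fun y => ENNReal.ofReal (Real.exp (lam * t)) *
      (ENNReal.ofReal (η y) * f y)) (Kernel.aemeasurable _)
      (Measurable.aemeasurable (by fun_prop)), ← Z.subLaw_eq_bind, h.quasiStationary,
    lintegral_smul_measure, smul_eq_mul, lintegral_const_mul _ (by fun_prop), ← mul_assoc,
    ← ENNReal.ofReal_mul (Real.exp_pos _).le, ← Real.exp_add]
  simp

/-- Since `e^{λ₀t} η = e^{λ₀} P_{1-t} η`, the Markov property moves the density from time `t` to the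
fixed time `1`. A single integrable variable then serves for all `t ≤ 1`, although `η` may be
unbounded and discontinuous. -/
theorem doobKernel_preimage_le {t : ℝ≥0} (ht : t ≤ 1) (x : Live cem) {A : Set S}
    (hA : MeasurableSet A) :
    Z.doobKernel η lam t x (Subtype.val ⁻¹' A) ≤ ∫⁻ ω in Z.X t ⁻¹' A,
      ENNReal.ofReal (extendZero (fun y => Real.exp lam / η x * η y) (Z.X 1 ω)) ∂Z.P x := by
  have hη := h.measurable_eta
  have hx := h.eta_pos x
  have hA' : MeasurableSet (Subtype.val ⁻¹' A : Set (Live cem)) := measurable_subtype_coe hA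
  have hfm : Measurable fun y => Real.exp lam / η x * η y := by fun_prop
  have h1 := Z.comap_restrict_eq_bind x t (1 - t) hA
  rw [add_tsub_cancel_of_le ht] at h1
  have h2 : Z.doobKernel η lam t x (Subtype.val ⁻¹' A) =
      ∫⁻ y in Subtype.val ⁻¹' A, ENNReal.ofReal (Real.exp (lam * t) / η x * η y)
        ∂Z.liveKernel t x :=
    Kernel.withDensity_apply' _ (h.measurable_doob_density _) _ _
  have h3 : ∀ y, ENNReal.ofReal (Real.exp (lam * t) / η x * η y) =
      ∫⁻ z, ENNReal.ofReal (Real.exp lam / η x * η z) ∂Z.liveKernel (1 - t) y := fun y => by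
    have he : Real.exp (lam * t) = Real.exp lam * Real.exp (-lam * (1 - t : ℝ≥0)) := by
      rw [← Real.exp_add, NNReal.coe_sub ht, NNReal.coe_one]
      congr 1
      ring
    rw [h.lintegral_const_mul_eta (by positivity), he]
    congr 1
    ring
  rw [h2]
  simp_rw [h3]
  rw [← Measure.lintegral_bind (Kernel.aemeasurable _)
    (hfm.ennreal_ofReal.aemeasurable), ← h1]
  have h4 : ∀ z : Live cem, ENNReal.ofReal (Real.exp lam / η x * η z) =
      ENNReal.ofReal (extendZero (fun y => Real.exp lam / η x * η y) (z : S)) := fun z => by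
    rw [extendZero_val]
  simp_rw [h4]
  rw [← measurableEmbedding_live.lintegral_map
      (f := fun z : S => ENNReal.ofReal (extendZero (fun y => Real.exp lam / η x * η y) z)),
    measurableEmbedding_live.map_comap]
  refine (setLIntegral_le_lintegral _ _).trans ?_
  rw [lintegral_map (measurable_extendZero hfm).ennreal_ofReal (Z.measurable_X 1)]

/-- Absolute continuity of the integral of the time-`1` variable, over events whose
`P_x`-probability tends to `0`. -/
theorem tendsto_doobKernel_compl_ball (x : Live cem) {ε : ℝ} (hε : 0 < ε) :
    Tendsto (fun t => Z.doobKernel η lam t x {y | ε ≤ dist y x}) (𝓝[>] 0) (𝓝 0) := by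
  have hη := h.measurable_eta
  have hfm : Measurable fun y => Real.exp lam / η x * η y := by fun_prop
  let A : Set S := {y | ENNReal.ofReal ε ≤ edist y x}
  have hA : MeasurableSet A := (isClosed_le continuous_const (by fun_prop)).measurableSet
  have hAe : (Subtype.val ⁻¹' A : Set (Live cem)) = {y | ε ≤ dist y x} := by
    ext y
    simp only [A, Set.mem_preimage, Set.mem_ofPred_eq, edist_dist, Subtype.dist_eq]
    exact ENNReal.ofReal_le_ofReal_iff dist_nonneg
  have hfin : ∫⁻ ω, ENNReal.ofReal (extendZero (fun y => Real.exp lam / η x * η y) (Z.X 1 ω))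
      ∂Z.P x ≠ ⊤ := by
    have hi := (Z.integrable_extendZero_X_iff 1 x h.measurable_eta).mp (h.eigenfunction 1 x).1
    have hi2 := (Z.integrable_extendZero_X_iff 1 x hfm).mpr (hi.const_mul _)
    exact ne_top_of_le_ne_top hi2.2.ne (lintegral_mono fun ω => Real.ofReal_le_enorm _)
  have hlim := tendsto_setLIntegral_zero hfin (s := fun t => Z.X t ⁻¹' A) (l := 𝓝[>] 0)
    (Z.continuous_zero x (ENNReal.ofReal ε) (ENNReal.ofReal_pos.mpr hε))
  refine tendsto_of_tendsto_of_tendsto_of_le_of_le' tendsto_const_nhds hlim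
    (Eventually.of_forall fun _ => zero_le) ?_
  have h1 : ∀ᶠ t : ℝ≥0 in 𝓝[>] 0, t ≤ 1 :=
    nhdsWithin_le_nhds (Iic_mem_nhds (zero_lt_one (α := ℝ≥0)))
  filter_upwards [h1] with t ht
  rw [← hAe]
  exact h.doobKernel_preimage_le ht x hA

theorem tendsto_integral_doobKernel (g : BoundedContinuousFunction (Live cem) ℝ) (x : Live cem) :
    Tendsto (fun t => ∫ y, g y ∂Z.doobKernel η lam t x) (𝓝[>] 0) (𝓝 (g x)) := by
  have hmk := h.isMarkovKernel_doobKernel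
  rw [Metric.tendsto_nhds]
  intro ε hε
  obtain ⟨δ, hδ, hg⟩ := Metric.continuous_iff.mp g.continuous x (ε / 2) (by positivity)
  -- The `+ 1` covers `g = 0`; off the `δ`-ball the oscillation of `g` is at most `2‖g‖`.
  have hb : 0 < ε / 2 / (2 * ‖g‖ + 1) := by positivity
  have h1 := (ENNReal.tendsto_toReal ENNReal.zero_ne_top).comp
    (h.tendsto_doobKernel_compl_ball x hδ)
  filter_upwards [h1.eventually (gt_mem_nhds hb)] with t ht
  change (Z.doobKernel η lam t x).real {y | δ ≤ dist y x} < _ at ht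
  set q := Z.doobKernel η lam t x
  have hms : MeasurableSet {y : Live cem | δ ≤ dist y x} :=
    (isClosed_le continuous_const (by fun_prop)).measurableSet
  have hsub : ∫ y, g y ∂q - g x = ∫ y, g y - g x ∂q := by
    rw [integral_sub (StationarySemigroup.integrable_bcf g) (integrable_const _)]
    simp
  have hpt : ∀ y, ‖g y - g x‖ ≤ ε / 2 + {y | δ ≤ dist y x}.indicator (fun _ => 2 * ‖g‖) y := by
    intro y
    by_cases hy : δ ≤ dist y x
    · rw [Set.indicator_of_mem (show y ∈ {y | δ ≤ dist y x} from hy)]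
      have := norm_sub_le (g y) (g x)
      have := g.norm_coe_le_norm y
      have := g.norm_coe_le_norm x
      linarith
    · rw [Set.indicator_of_notMem (show y ∉ {y | δ ≤ dist y x} from hy), add_zero, ← dist_eq_norm]
      exact (hg y (not_le.mp hy)).le
  have hiB : Integrable ({y : Live cem | δ ≤ dist y x}.indicator fun _ => 2 * ‖g‖) q :=
    (integrable_const _).indicator hms
  rw [dist_eq_norm, hsub]
  calc _ ≤ ∫ y, ‖g y - g x‖ ∂q := norm_integral_le_integral_norm _
    _ ≤ ∫ y, ε / 2 + {y | δ ≤ dist y x}.indicator (fun _ => 2 * ‖g‖) y ∂q :=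
        integral_mono ((StationarySemigroup.integrable_bcf g).sub (integrable_const _)).norm
          ((integrable_const _).add hiB) hpt
    _ = ε / 2 + q.real {y | δ ≤ dist y x} * (2 * ‖g‖) := by
        rw [integral_add (integrable_const _) hiB, integral_indicator hms]
        simp
    _ < ε := by
        rw [lt_div_iff₀ (by positivity)] at ht
        have : 0 ≤ q.real {y | δ ≤ dist y x} := measureReal_nonneg
        nlinarith

theorem stationarySemigroup :
    StationarySemigroup (Z.doobKernel η lam) (weighted η α) where
  isMarkovKernel := h.isMarkovKernel_doobKernel
  zero := h.doobKernel_zero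
  add := h.doobKernel_add
  invariant := h.doobKernel_invariant
  tendsto := h.tendsto_integral_doobKernel

end PoincareAssumptions

end AbsorbedMarkovProcess

end QSD

/-! ### Time averages lie in the energy domain. -/

namespace QSD

theorem tendsto_slope_nnreal {φ : ℝ → ℝ} {φ' t : ℝ}
    (hφ : HasDerivWithinAt φ φ' (Set.Ici t) t) :
    Tendsto (fun r : ℝ≥0 => (φ (t + r) - φ t) / r) (𝓝[>] 0) (𝓝 φ') := by
  rw [hasDerivWithinAt_iff_tendsto_slope, Set.Ici_sdiff_left] at hφ
  have hs : Tendsto (fun r : ℝ≥0 => t + (r : ℝ)) (𝓝[>] 0) (𝓝[>] t) := by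
    refine tendsto_nhdsWithin_iff.mpr ⟨?_, ?_⟩
    · have : Tendsto (fun r : ℝ≥0 => t + (r : ℝ)) (𝓝 0) (𝓝 (t + (0 : ℝ≥0))) :=
        (continuous_const.add NNReal.continuous_coe).tendsto 0
      rw [NNReal.coe_zero, add_zero] at this
      exact this.mono_left nhdsWithin_le_nhds
    · exact eventually_nhdsWithin_of_forall fun r hr =>
        Set.mem_Ioi.mpr (lt_add_of_pos_right t (NNReal.coe_pos.mpr hr))
  refine (hφ.comp hs).congr fun r => ?_
  simp only [Function.comp_apply, slope, add_sub_cancel_left, vsub_eq_sub, smul_eq_mul]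
  rw [inv_mul_eq_div]

theorem tendsto_eLpNorm_two_zero {E ι : Type*} [MeasurableSpace E] {μ : Measure E}
    [IsFiniteMeasure μ] {l : Filter ι} [l.IsCountablyGenerated] {f : ι → E → ℝ} (B : ℝ)
    (hm : ∀ᶠ i in l, Measurable (f i)) (hB : ∀ᶠ i in l, ∀ x, |f i x| ≤ B)
    (hlim : ∀ x, Tendsto (fun i => f i x) l (𝓝 0)) :
    Tendsto (fun i => eLpNorm (f i) 2 μ) l (𝓝 0) := by
  have h1 : Tendsto (fun i => ∫⁻ x, ‖f i x‖ₑ ^ 2 ∂μ) l (𝓝 (∫⁻ _, 0 ∂μ)) := by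
    refine tendsto_lintegral_filter_of_dominated_convergence (fun _ => ENNReal.ofReal B ^ 2)
      (hm.mono fun i hi => hi.enorm.pow_const 2)
      (hB.mono fun i hi => ae_of_all _ fun x => ?_) ?_ (ae_of_all _ fun x => ?_)
    · rw [Real.enorm_eq_ofReal_abs]
      gcongr
      exact hi x
    · rw [lintegral_const]
      finiteness
    · have h2 := ((continuous_enorm (E := ℝ)).tendsto 0).comp (hlim x)
      rw [enorm_zero] at h2
      simpa using ENNReal.Tendsto.pow (n := 2) h2
  rw [lintegral_zero] at h1
  simp_rw [← eLpNorm_two_sq] at h1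
  have h3 := ((ENNReal.continuous_rpow_const (y := (1 / 2 : ℝ))).tendsto 0).comp h1
  rw [ENNReal.zero_rpow_of_pos (by norm_num)] at h3
  refine h3.congr fun i => ?_
  simp only [Function.comp_apply]
  rw [← ENNReal.rpow_natCast, ← ENNReal.rpow_mul]
  norm_num

namespace AbsorbedMarkovProcess

variable {S Ω : Type*} [MetricSpace S] [MeasurableSpace S] [BorelSpace S] [MeasurableSpace Ω]
  {cem : S} {Z : AbsorbedMarkovProcess S Ω cem}
  {α : Measure (Live cem)} {η : Live cem → ℝ} {lam C : ℝ} {ψ : Live cem → ℝ}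

theorem generator_eq_of_tendsto {f : Live cem → ℝ} {x : Live cem} {l : ℝ}
    (hl : Tendsto (fun t : ℝ≥0 => (Z.semigroup t f x - f x) / t) (𝓝[>] 0) (𝓝 l)) :
    Z.generator f x = l :=
  hl.limUnder_eq

namespace PoincareAssumptions

variable (h : Z.PoincareAssumptions α η lam C ψ)
include h

theorem generator_eta (x : Live cem) : Z.generator η x = -lam * η x := by
  refine generator_eq_of_tendsto ?_
  have hd : HasDerivAt (fun u : ℝ => Real.exp (-lam * u) * η x) (-lam * η x) 0 := by
    have h1 : HasDerivAt (fun u : ℝ => -lam * u) (-lam * 1) 0 := (hasDerivAt_id 0).const_mul _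
    simpa using h1.exp.mul_const (η x)
  refine (tendsto_slope_nnreal hd.hasDerivWithinAt).congr fun r => ?_
  rw [(h.eigenfunction r x).2]
  simp

theorem semigroup_mul_eta {f : Live cem → ℝ} (hf : Measurable f) (t : ℝ≥0) (x : Live cem) :
    Z.semigroup t (fun y => f y * η y) x =
      η x * (Real.exp (-lam * t) * ∫ y, f y ∂Z.doobKernel η lam t x) := by
  have hx := h.eta_pos x
  rw [Z.semigroup_eq t x (f := fun y => f y * η y) (hf.mul h.measurable_eta),
    h.integral_doobKernel, neg_mul, Real.exp_neg]
  field_simp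

theorem integrable_mul_eta {f : Live cem → ℝ} (hf : Measurable f) {B : ℝ} (hB : ∀ x, |f x| ≤ B)
    (t : ℝ≥0) (x : Live cem) :
    Integrable (fun ω => extendZero (fun y => f y * η y) (Z.X t ω)) (Z.P x) := by
  rw [Z.integrable_extendZero_X_iff t x (f := fun y => f y * η y) (hf.mul h.measurable_eta)]
  exact ((Z.integrable_extendZero_X_iff t x h.measurable_eta).mp
    (h.eigenfunction t x).1).bdd_mul hf.aestronglyMeasurable (ae_of_all _ hB)

/-- Since `P_r(U_t η) = η e^{-λ₀r} U_{t+r}`, the difference quotient divided by `η` is bounded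
uniformly in small `r` and converges at every point. Dominated convergence upgrades this to `L²(β)`.
The eigenvalue term is cancelled by `Lη = -λ₀η`. -/
theorem inEnergyDomain_flowMean (g : BoundedContinuousFunction (Live cem) ℝ) {u t : ℝ}
    (hu : 0 < u) (ht : 0 ≤ t) :
    Z.InEnergyDomain η (weighted η α) (flowMean (Z.doobKernel η lam) g u t) ∧
      ∀ x, Z.doobGenerator η (flowMean (Z.doobKernel η lam) g u t) x =
        flow (Z.doobKernel η lam) g (t + u) x - flow (Z.doobKernel η lam) g t x := by
  have hQ := h.stationarySemigroup
  have hprob := h.isProbabilityMeasure_weighted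
  have hη := h.measurable_eta
  set Q := Z.doobKernel η lam with hQdef
  set U := flowMean Q g u with hU
  have hUm : ∀ s, Measurable (U s) := hQ.measurable_flowMean g u
  have hUb : ∀ s x, |U s x| ≤ ‖g‖ * |u| := hQ.abs_flowMean_le g u
  set A : Live cem → ℝ := fun x => flow Q g (t + u) x - flow Q g t x with hA
  have hAm : Measurable A := (StationarySemigroup.measurable_flow g _).sub
    (StationarySemigroup.measurable_flow g _)
  have hAb : ∀ x, |A x| ≤ 2 * ‖g‖ := fun x => by
    have := abs_sub (flow Q g (t + u) x) (flow Q g t x)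
    have := hQ.abs_flow_le g (t + u) x
    have := hQ.abs_flow_le g t x
    simp only [hA]
    linarith
  let R : ℝ≥0 → Live cem → ℝ := fun r x => (Real.exp (-lam * r) * U (t + r) x - U t x) / r
  have hquot : ∀ (r : ℝ≥0) x, (Z.semigroup r (fun y => U t y * η y) x - U t x * η x) / r =
      η x * R r x := fun r x => by
    rw [h.semigroup_mul_eta (hUm t), hU, hQ.integral_flowMean g hu.le ht, add_comm (r : ℝ) t]
    simp only [R]
    ring
  have hR : ∀ x, Tendsto (fun r => R r x) (𝓝[>] 0) (𝓝 (A x - lam * U t x)) := fun x => by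
    have h1 : HasDerivAt (fun v : ℝ => Real.exp (-lam * (v - t))) (-lam) t := by
      have h2 : HasDerivAt (fun v : ℝ => -lam * (v - t)) (-lam * 1) t :=
        ((hasDerivAt_id t).sub_const t).const_mul _
      simpa using h2.exp
    have h3 := tendsto_slope_nnreal
      (h1.hasDerivWithinAt.mul (hQ.hasDerivWithinAt_flowMean g u t x))
    have h4 : A x - lam * U t x = -lam * flowMean Q g u t x +
        Real.exp (-lam * (t - t)) * (flow Q g (t + u) x - flow Q g t x) := by
      simp only [hA, hU, sub_self, mul_zero, Real.exp_zero, one_mul]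
      ring
    rw [h4]
    refine h3.congr fun r => ?_
    simp [R, hU]
  have hgen : ∀ x, Tendsto (fun r : ℝ≥0 =>
      (Z.semigroup r (fun y => U t y * η y) x - U t x * η x) / r) (𝓝[>] 0)
      (𝓝 (η x * (A x - lam * U t x))) := fun x => by
    simp_rw [hquot]
    exact (hR x).const_mul _
  have hgeneq : ∀ x, Z.generator (fun y => U t y * η y) x = η x * (A x - lam * U t x) :=
    fun x => generator_eq_of_tendsto (hgen x)
  refine ⟨⟨hUm t, .of_bound (hUm t).aestronglyMeasurable _ (ae_of_all _ (hUb t)),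
    ⟨(hUm t).mul hη, fun s x => h.integrable_mul_eta (hUm t) (hUb t) s x,
      fun x => ⟨_, hgen x⟩⟩, ?_⟩, fun x => ?_⟩
  · have heq : ∀ (r : ℝ≥0) x, ((Z.semigroup r (fun y => U t y * η y) x - U t x * η x) / r -
        Z.generator (fun y => U t y * η y) x) / η x = R r x - (A x - lam * U t x) := fun r x => by
      have := (h.eta_pos x).ne'
      rw [hquot, hgeneq]
      field_simp
    simp_rw [heq]
    refine tendsto_eLpNorm_two_zero
      (2 * ‖g‖ + lam * (‖g‖ * |u|) + (2 * ‖g‖ + lam * (‖g‖ * |u|)))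
      (Eventually.of_forall fun r => ?_)
      (eventually_nhdsWithin_of_forall fun r hr x => ?_) (fun x => ?_)
    · exact ((((hUm _).const_mul _).sub (hUm t)).div_const _).sub (hAm.sub ((hUm t).const_mul _))
    · have hr' : (0 : ℝ) < r := NNReal.coe_pos.mpr hr
      have hl := h.lam_pos
      have e1 : |R r x| ≤ 2 * ‖g‖ + lam * (‖g‖ * |u|) := by
        -- Each piece is of order `r` uniformly in `x`: the first by the Lipschitz bound on `U`, the
        -- second by `1 - e^{-λ₀r} ≤ λ₀r`.
        have e2 : Real.exp (-lam * r) * U (t + r) x - U t x =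
            Real.exp (-lam * r) * (U (t + r) x - U t x) - (1 - Real.exp (-lam * r)) * U t x := by
          ring
        have e3 : Real.exp (-lam * r) ≤ 1 := by
          rw [Real.exp_le_one_iff]
          nlinarith
        have e4 : 1 - Real.exp (-lam * r) ≤ lam * r := by
          linarith [Real.add_one_le_exp (-lam * r)]
        have e5 := hQ.abs_flowMean_sub_le g u t (t + r) x
        rw [add_sub_cancel_left, abs_of_pos hr'] at e5
        simp only [R]
        rw [abs_div, abs_of_pos hr', div_le_iff₀ hr', e2]
        refine (abs_sub _ _).trans ?_
        rw [abs_mul, abs_mul, abs_of_pos (Real.exp_pos _), abs_of_nonneg (sub_nonneg.mpr e3)]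
        calc _ ≤ 1 * (2 * ‖g‖ * r) + lam * r * (‖g‖ * |u|) := by
              gcongr
              exact hUb t x
          _ = _ := by ring
      have e6 : |A x - lam * U t x| ≤ 2 * ‖g‖ + lam * (‖g‖ * |u|) := by
        refine (abs_sub _ _).trans (add_le_add (hAb x) ?_)
        rw [abs_mul, abs_of_pos hl]
        gcongr
        exact hUb t x
      exact (abs_sub _ _).trans (add_le_add e1 e6)
    · simpa using (hR x).sub_const (A x - lam * U t x)
  · have := (h.eta_pos x).ne'
    rw [doobGenerator, hgeneq, h.generator_eta]
    field_simp
    ring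

/-- By invariance `U_t` has mean `u β(g) = 0`, so its variance is its second moment and the Poincaré
inequality takes the form Gronwall needs. -/
theorem integral_flowMean_sq_le (g : BoundedContinuousFunction (Live cem) ℝ)
    (hg : ∫ x, g x ∂weighted η α = 0) (u t : ℝ) (hu : 0 < u) (ht : 0 ≤ t) :
    ∫ x, flowMean (Z.doobKernel η lam) g u t x ^ 2 ∂weighted η α ≤
      -C * ∫ x, flowMean (Z.doobKernel η lam) g u t x *
        (flow (Z.doobKernel η lam) g (t + u) x - flow (Z.doobKernel η lam) g t x)
          ∂weighted η α := by
  have hQ := h.stationarySemigroup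
  have hprob := h.isProbabilityMeasure_weighted
  obtain ⟨h1, h2⟩ := h.inEnergyDomain_flowMean g hu ht
  have h3 := h.poincare _ h1
  rw [variance_of_integral_eq_zero h1.1.aemeasurable
    (by rw [hQ.integral_flowMean_invariant g hu.le, hg, mul_zero])] at h3
  simpa only [h2] using h3

end PoincareAssumptions

end AbsorbedMarkovProcess

end QSD

/-! ### From the Doob transform back to the conditioned law. -/

namespace QSD

namespace AbsorbedMarkovProcess

variable {S Ω : Type*} [MetricSpace S] [MeasurableSpace S] [BorelSpace S] [MeasurableSpace Ω]
  {cem : S} {Z : AbsorbedMarkovProcess S Ω cem}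
  {α : Measure (Live cem)} {η : Live cem → ℝ} {lam C : ℝ} {ψ : Live cem → ℝ}

namespace PoincareAssumptions

variable (h : Z.PoincareAssumptions α η lam C ψ)
include h

theorem integral_weighted (f : Live cem → ℝ) :
    ∫ x, f x / η x ∂weighted η α = ∫ x, f x ∂α := by
  rw [h.weighted_eq]
  refine (integral_withDensity_eq_integral_smul h.measurable_eta.real_toNNReal _).trans ?_
  refine integral_congr_ae (ae_of_all _ fun x => ?_)
  have hx := h.eta_pos x
  simp only [NNReal.smul_def, Real.coe_toNNReal _ hx.le, smul_eq_mul]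
  field_simp

theorem memLp_div_eta {f : Live cem → ℝ} (hf : Measurable f) (hle : ∀ x, |f x| ≤ ψ x) :
    MemLp (fun x => f x / η x) 2 (weighted η α) := by
  have hm : Measurable fun x => f x / η x := hf.div h.measurable_eta
  have hd : ∀ x, η x * (f x / η x) ^ 2 = f x ^ 2 / η x := fun x => by
    have := (h.eta_pos x).ne'
    field_simp
  rw [memLp_two_iff_integrable_sq hm.aestronglyMeasurable, h.weighted_eq]
  refine (integrable_withDensity_iff_integrable_smul h.measurable_eta.real_toNNReal).mpr ?_
  simp only [NNReal.smul_def, Real.coe_toNNReal _ (h.eta_pos _).le, smul_eq_mul, hd]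
  refine h.integrable_psi_sq_div.mono' ((hf.pow_const 2).div h.measurable_eta).aestronglyMeasurable
    (ae_of_all _ fun x => ?_)
  have hx := h.eta_pos x
  rw [Real.norm_of_nonneg (by positivity), ← sq_abs]
  gcongr
  exact hle x

theorem eLpNorm_div_eta_le {f : Live cem → ℝ} (hle : ∀ x, |f x| ≤ ψ x) :
    eLpNorm (fun x => f x / η x) 2 (weighted η α) ≤
      ENNReal.ofReal √(∫ x, ψ x ^ 2 / η x ∂α) := by
  have hψ0 : ∀ x, 0 ≤ ψ x := fun x => zero_le_one.trans (h.one_le_psi x)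
  have hψ := h.memLp_div_eta h.measurable_psi fun x => (abs_of_nonneg (hψ0 x)).le
  have hsq : ∫ x, (ψ x / η x) ^ 2 ∂weighted η α = ∫ x, ψ x ^ 2 / η x ∂α := by
    rw [← h.integral_weighted]
    simp_rw [div_pow, div_div, sq (η _)]
  rw [← hsq, ← eLpNorm_two_eq_ofReal_sqrt hψ]
  refine eLpNorm_mono_real fun x => ?_
  rw [Real.norm_eq_abs, abs_div, abs_of_pos (h.eta_pos x)]
  have hx := h.eta_pos x
  gcongr
  exact hle x

theorem abs_integral_bind_sub_le {ν : Measure (Live cem)} [IsProbabilityMeasure ν]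
    (hν : ν ≪ weighted η α) (hχ : chi2 ν (weighted η α) ≠ ⊤) {f : Live cem → ℝ}
    (hf : Measurable f) (hle : ∀ x, |f x| ≤ ψ x) (t : ℝ≥0) :
    |(∫ x, f x / η x ∂ν.bind (Z.doobKernel η lam t)) - ∫ x, f x ∂α| ≤
      (chi2 ν (weighted η α)).toReal *
        (Real.exp (-(t : ℝ) / C) * √(∫ x, ψ x ^ 2 / η x ∂α)) := by
  have hprob := h.isProbabilityMeasure_weighted
  have h1 := h.stationarySemigroup.enorm_integral_bind_sub_le h.C_pos
    h.integral_flowMean_sq_le hν hχ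
    (f := fun x => f x / η x) (hf.div h.measurable_eta) (h.memLp_div_eta hf hle) t
  rw [h.integral_weighted, Real.enorm_eq_ofReal_abs] at h1
  rw [← ENNReal.ofReal_le_ofReal_iff (by positivity), ENNReal.ofReal_mul ENNReal.toReal_nonneg,
    ENNReal.ofReal_toReal hχ, ENNReal.ofReal_mul (Real.exp_pos _).le]
  refine h1.trans ?_
  gcongr
  exact h.eLpNorm_div_eta_le hle

/-- Inverting the Doob transform: `μP_t(f) = e^{-λ₀t} μ(η) · (η*μ)Q_t(f/η)`. The scalar disappears
on conditioning. -/
theorem subLaw_eq_smul {μ : Measure (Live cem)}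
    (h0 : ∫⁻ x, ENNReal.ofReal (η x) ∂μ ≠ 0) (htop : ∫⁻ x, ENNReal.ofReal (η x) ∂μ ≠ ⊤)
    (t : ℝ≥0) :
    Z.subLaw μ t =
      (ENNReal.ofReal (Real.exp (-lam * t)) * ∫⁻ x, ENNReal.ofReal (η x) ∂μ) •
        ((weighted η μ).bind (Z.doobKernel η lam t)).withDensity
          fun x => ENNReal.ofReal (η x)⁻¹ := by
  refine Measure.ext_of_lintegral _ fun f hf => ?_
  have hη := h.measurable_eta
  have hηm : Measurable fun x => ENNReal.ofReal (η x) := hη.ennreal_ofReal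
  have hiηm : Measurable fun x => ENNReal.ofReal (η x)⁻¹ := hη.inv.ennreal_ofReal
  have hif : Measurable ((fun x => ENNReal.ofReal (η x)⁻¹) * f) := hiηm.mul hf
  rw [Z.subLaw_eq_bind, Measure.lintegral_bind (Kernel.aemeasurable _) hf.aemeasurable,
    lintegral_smul_measure, lintegral_withDensity_eq_lintegral_mul _ hiηm hf,
    Measure.lintegral_bind (Kernel.aemeasurable _) hif.aemeasurable, weighted,
    lintegral_smul_measure, lintegral_withDensity_eq_lintegral_mul _ hηm hif.lintegral_kernel,
    smul_eq_mul, smul_eq_mul, ← mul_assoc, mul_assoc (ENNReal.ofReal _),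
    ENNReal.mul_inv_cancel h0 htop, mul_one,
    ← lintegral_const_mul _ (hηm.mul hif.lintegral_kernel)]
  refine lintegral_congr fun x => ?_
  have hx := h.eta_pos x
  rw [Pi.mul_apply, h.lintegral_doobKernel t x hif, ← mul_assoc,
    ← ENNReal.ofReal_mul (Real.exp_pos _).le, ← lintegral_const_mul _ (by fun_prop)]
  refine lintegral_congr fun y => ?_
  have hy := h.eta_pos y
  rw [Pi.mul_apply, ← mul_assoc, ← mul_assoc, ← ENNReal.ofReal_mul (by positivity),
    ← ENNReal.ofReal_mul (by positivity)]
  have h1 : Real.exp (-lam * t) * η x * (Real.exp (lam * t) / η x * η y) * (η y)⁻¹ = 1 := by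
    rw [neg_mul, Real.exp_neg]
    field_simp
  rw [h1, ENNReal.ofReal_one, one_mul]

theorem lintegral_eta_ne_zero {μ : Measure (Live cem)} [IsProbabilityMeasure μ] :
    ∫⁻ x, ENNReal.ofReal (η x) ∂μ ≠ 0 := by
  rw [Ne, lintegral_eq_zero_iff h.measurable_eta.ennreal_ofReal]
  intro h0
  obtain ⟨x, hx⟩ := h0.exists
  exact (ENNReal.ofReal_pos.mpr (h.eta_pos x)).ne' hx

theorem isProbabilityMeasure_weighted_of_lt_top {μ : Measure (Live cem)} [IsProbabilityMeasure μ]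
    (htop : ∫⁻ x, ENNReal.ofReal (η x) ∂μ ≠ ⊤) : IsProbabilityMeasure (weighted η μ) := by
  refine ⟨?_⟩
  rw [weighted, Measure.smul_apply, withDensity_apply _ .univ, setLIntegral_univ, smul_eq_mul,
    ENNReal.inv_mul_cancel h.lintegral_eta_ne_zero htop]

theorem condLaw_eq {μ : Measure (Live cem)} [IsProbabilityMeasure μ]
    (htop : ∫⁻ x, ENNReal.ofReal (η x) ∂μ ≠ ⊤) (t : ℝ≥0)
    (hi : Integrable (fun x => 1 / η x) ((weighted η μ).bind (Z.doobKernel η lam t))) :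
    Z.condLaw μ t =
      (ENNReal.ofReal (∫ x, 1 / η x ∂(weighted η μ).bind (Z.doobKernel η lam t)))⁻¹ •
        ((weighted η μ).bind (Z.doobKernel η lam t)).withDensity
          fun x => ENNReal.ofReal (η x)⁻¹ := by
  have h0 := h.lintegral_eta_ne_zero (μ := μ)
  have hc0 : ENNReal.ofReal (Real.exp (-lam * t)) * ∫⁻ x, ENNReal.ofReal (η x) ∂μ ≠ 0 :=
    mul_ne_zero (ENNReal.ofReal_pos.mpr (Real.exp_pos _)).ne' h0
  have hct : ENNReal.ofReal (Real.exp (-lam * t)) * ∫⁻ x, ENNReal.ofReal (η x) ∂μ ≠ ⊤ :=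
    ENNReal.mul_ne_top ENNReal.ofReal_ne_top htop
  have hw : (((weighted η μ).bind (Z.doobKernel η lam t)).withDensity
      fun x => ENNReal.ofReal (η x)⁻¹) Set.univ =
      ENNReal.ofReal (∫ x, 1 / η x ∂(weighted η μ).bind (Z.doobKernel η lam t)) := by
    rw [withDensity_apply _ .univ, setLIntegral_univ, ofReal_integral_eq_lintegral_ofReal hi
      (ae_of_all _ fun x => (one_div_pos.mpr (h.eta_pos x)).le)]
    simp_rw [one_div]
  rw [Z.condLaw_eq_smul, h.subLaw_eq_smul h0 htop, Measure.smul_apply, hw, smul_eq_mul, smul_smul,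
    ENNReal.mul_inv (.inl hc0) (.inl hct), mul_right_comm, ENNReal.inv_mul_cancel hc0 hct, one_mul]

theorem wasserstein1_condLaw_le {x₀ : Live cem} (hdist : ∀ x, dist x x₀ ≤ ψ x)
    {μ : Measure (Live cem)} [IsProbabilityMeasure μ]
    (htop : ∫⁻ x, ENNReal.ofReal (η x) ∂μ ≠ ⊤)
    (hχ : chi2 (weighted η μ) (weighted η α) ≠ ⊤) (t : ℝ≥0)
    (ht : (chi2 (weighted η μ) (weighted η α)).toReal *
        (Real.exp (-(t : ℝ) / C) * √(∫ x, ψ x ^ 2 / η x ∂α)) ≤ 1 / 2) :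
    wasserstein1 (Z.condLaw μ t) α ≤ ENNReal.ofReal ((2 + 2 * ∫ x, ψ x ∂α) *
      ((chi2 (weighted η μ) (weighted η α)).toReal *
        (Real.exp (-(t : ℝ) / C) * √(∫ x, ψ x ^ 2 / η x ∂α)))) := by
  have hα := h.isProbabilityMeasure
  have hβ := h.isProbabilityMeasure_weighted
  have hν := h.isProbabilityMeasure_weighted_of_lt_top htop
  have hψ0 : ∀ x, 0 ≤ ψ x := fun x => zero_le_one.trans (h.one_le_psi x)
  have hac : weighted η μ ≪ weighted η α := by
    by_contra hn
    exact hχ (if_neg hn)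
  set ν := weighted η μ
  set m := ν.bind (Z.doobKernel η lam t)
  set δ := (chi2 ν (weighted η α)).toReal *
    (Real.exp (-(t : ℝ) / C) * √(∫ x, ψ x ^ 2 / η x ∂α)) with hδ
  have hbd : ∀ f : Live cem → ℝ, Measurable f → (∀ x, |f x| ≤ ψ x) →
      |(∫ x, f x / η x ∂m) - ∫ x, f x ∂α| ≤ δ := fun f hf hle =>
    h.abs_integral_bind_sub_le hac hχ hf hle t
  have hint : ∀ f : Live cem → ℝ, Measurable f → (∀ x, |f x| ≤ ψ x) →
      Integrable (fun x => f x / η x) m := fun f hf hle =>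
    h.stationarySemigroup.integrable_bind hac hχ (hf.div h.measurable_eta)
      (h.memLp_div_eta hf hle) t
  have hone : ∀ x : Live cem, |(1 : ℝ)| ≤ ψ x := fun x => by simpa using h.one_le_psi x
  set D := ∫ x, 1 / η x ∂m with hD
  -- The normalization is the case `f = 1`, admissible because `ψ ≥ 1`.
  have hD1 : |D - 1| ≤ δ := by
    simpa [hD] using hbd (fun _ => 1) measurable_const hone
  have hDhalf : 1 / 2 ≤ D := by linarith [(abs_le.mp hD1).1]
  have hDpos : 0 < D := by linarith
  have hcond : Z.condLaw μ t =
      (ENNReal.ofReal D)⁻¹ • m.withDensity fun x => ENNReal.ofReal (η x)⁻¹ :=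
    h.condLaw_eq htop t (hint (fun _ => 1) measurable_const hone)
  have hiη : Measurable fun x => (η x)⁻¹.toNNReal := h.measurable_eta.inv.real_toNNReal
  have hsm : ∀ (f : Live cem → ℝ) x, (η x)⁻¹.toNNReal • f x = f x / η x := fun f x => by
    rw [NNReal.smul_def, Real.coe_toNNReal _ (inv_pos.mpr (h.eta_pos x)).le, smul_eq_mul,
      inv_mul_eq_div]
  have hDinv : (ENNReal.ofReal D)⁻¹ ≠ ⊤ :=
    ENNReal.inv_ne_top.mpr (ENNReal.ofReal_pos.mpr hDpos).ne'
  have hcint : ∀ f : Live cem → ℝ, ∫ x, f x ∂Z.condLaw μ t = D⁻¹ * ∫ x, f x / η x ∂m :=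
    fun f => by
      rw [hcond, integral_smul_measure, ENNReal.toReal_inv, ENNReal.toReal_ofReal hDpos.le,
        smul_eq_mul]
      congr 1
      refine (integral_withDensity_eq_integral_smul hiη f).trans ?_
      simp_rw [hsm]
  have hcprob : IsProbabilityMeasure (Z.condLaw μ t) := by
    refine ⟨?_⟩
    rw [hcond, Measure.smul_apply, withDensity_apply _ .univ, setLIntegral_univ, smul_eq_mul]
    have : ∫⁻ x, ENNReal.ofReal (η x)⁻¹ ∂m = ENNReal.ofReal D := by
      rw [hD, ofReal_integral_eq_lintegral_ofReal (hint (fun _ => 1) measurable_const hone)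
        (ae_of_all _ fun x => (one_div_pos.mpr (h.eta_pos x)).le)]
      simp_rw [one_div]
    rw [this, ENNReal.inv_mul_cancel (ENNReal.ofReal_pos.mpr hDpos).ne' ENNReal.ofReal_ne_top]
  have hψi : Integrable ψ (Z.condLaw μ t) := by
    rw [hcond]
    refine Integrable.smul_measure ?_ hDinv
    refine (integrable_withDensity_iff_integrable_smul hiη).mpr ?_
    simp_rw [hsm]
    exact hint ψ h.measurable_psi fun x => (abs_of_nonneg (hψ0 x)).le
  refine wasserstein1_le_of_abs_le h.measurable_psi hdist hψi h.integrable_psi fun f hf hle => ?_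
  have hfa : |∫ x, f x ∂α| ≤ ∫ x, ψ x ∂α :=
    norm_integral_le_of_norm_le (f := f) h.integrable_psi (ae_of_all _ hle)
  have hN := hbd f hf hle
  set N := ∫ x, f x / η x ∂m
  set a := ∫ x, f x ∂α
  have hP0 : 0 ≤ ∫ x, ψ x ∂α := integral_nonneg hψ0
  have hδ0 : 0 ≤ δ := (abs_nonneg _).trans hN
  rw [hcint f]
  -- The numerator is at most `(1 + α(ψ)) δ`, and `D ≥ 1/2` contributes the factor `2`.
  have e1 : D⁻¹ * N - a = ((N - a) - a * (D - 1)) / D := by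
    field_simp
    ring
  have e2 : N - a - a * (D - 1) ≤ δ + (∫ x, ψ x ∂α) * δ := by
    have h1 := (le_abs_self _).trans (abs_sub (N - a) (a * (D - 1)))
    rw [abs_mul] at h1
    exact h1.trans (by gcongr)
  rw [e1, div_le_iff₀ hDpos]
  refine e2.trans ?_
  have e3 : 0 ≤ (2 + 2 * ∫ x, ψ x ∂α) * δ := by positivity
  nlinarith

theorem integral_psi_sq_div_pos : 0 < ∫ x, ψ x ^ 2 / η x ∂α := by
  have hα := h.isProbabilityMeasure
  have hpos : ∀ x, 0 < ψ x ^ 2 / η x := fun x =>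
    div_pos (pow_pos (zero_lt_one.trans_le (h.one_le_psi x)) 2) (h.eta_pos x)
  rw [integral_pos_iff_support_of_nonneg (fun x => (hpos x).le) h.integrable_psi_sq_div]
  have : Function.support (fun x => ψ x ^ 2 / η x) = Set.univ :=
    Set.eq_univ_of_forall fun x => (hpos x).ne'
  rw [this, measure_univ]
  exact one_pos

theorem exists_wasserstein1_condLaw_le {x₀ : Live cem} (hdist : ∀ x, dist x x₀ ≤ ψ x)
    {μ : Measure (Live cem)} [IsProbabilityMeasure μ]
    (htop : ∫⁻ x, ENNReal.ofReal (η x) ∂μ < ⊤) :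
    ∃ T : ℝ≥0, ∀ t : ℝ≥0, T ≤ t → wasserstein1 (Z.condLaw μ t) α ≤
      ENNReal.ofReal ((2 + 2 * ∫ x, ψ x ∂α) * √(∫ x, ψ x ^ 2 / η x ∂α)) *
        chi2 (weighted η μ) (weighted η α) * ENNReal.ofReal (Real.exp (-(t : ℝ) / C)) := by
  have hP0 : 0 ≤ ∫ x, ψ x ∂α :=
    integral_nonneg fun x => zero_le_one.trans (h.one_le_psi x)
  have hK := Real.sqrt_pos.mpr h.integral_psi_sq_div_pos
  -- If the divergence is infinite, positivity of the other factors makes the bound infinite and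
  -- every time works. Otherwise the threshold is a time after which `δ(t) ≤ 1/2`.
  rcases eq_or_ne (chi2 (weighted η μ) (weighted η α)) ⊤ with hχ | hχ
  · refine ⟨0, fun t _ => ?_⟩
    rw [hχ, ENNReal.mul_top (ENNReal.ofReal_pos.mpr (by positivity)).ne',
      ENNReal.top_mul (ENNReal.ofReal_pos.mpr (Real.exp_pos _)).ne']
    exact le_top
  · have hlim : Tendsto (fun t : ℝ≥0 => (chi2 (weighted η μ) (weighted η α)).toReal *
        (Real.exp (-(t : ℝ) / C) * √(∫ x, ψ x ^ 2 / η x ∂α))) atTop (𝓝 0) := by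
      have h1 : Tendsto (fun t : ℝ≥0 => (t : ℝ) / C) atTop atTop :=
        (NNReal.tendsto_coe_atTop.mpr tendsto_id).atTop_div_const h.C_pos
      have h2 := ((Real.tendsto_exp_neg_atTop_nhds_zero.comp h1).mul_const
        √(∫ x, ψ x ^ 2 / η x ∂α)).const_mul (chi2 (weighted η μ) (weighted η α)).toReal
      simpa [Function.comp_def, neg_div] using h2
    obtain ⟨T, hT⟩ := eventually_atTop.mp (hlim.eventually (ge_mem_nhds one_half_pos))
    refine ⟨T, fun t ht => (h.wasserstein1_condLaw_le hdist htop.ne hχ t (hT t ht)).trans_eq ?_⟩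
    conv_rhs => rw [← ENNReal.ofReal_toReal hχ]
    rw [← ENNReal.ofReal_mul (by positivity), ← ENNReal.ofReal_mul (by positivity)]
    congr 1
    ring

end PoincareAssumptions

end AbsorbedMarkovProcess

end QSD

theorem mainTheorem5 :
    ∃ a b : ℝ, 0 < a ∧ 0 < b ∧
      ∀ (S Ω : Type*) [MetricSpace S] [MeasurableSpace S] [BorelSpace S] [MeasurableSpace Ω]
        (cem : S) (Z : QSD.AbsorbedMarkovProcess S Ω cem)
        (α : Measure (QSD.Live cem)) (η : QSD.Live cem → ℝ) (lam C : ℝ)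
        (x₀ : QSD.Live cem),
        Z.PoincareAssumptions α η lam C (fun x => 1 + dist x x₀) →
        ∀ μ : Measure (QSD.Live cem), IsProbabilityMeasure μ →
          (∫⁻ x, ENNReal.ofReal (η x) ∂μ) < ⊤ →
          ∃ tμ : ℝ≥0, ∀ t : ℝ≥0, tμ ≤ t →
            QSD.wasserstein1 (Z.condLaw μ t) α ≤
              ENNReal.ofReal
                  ((a + b * ∫ x, (1 + dist x x₀) ∂α) *
                    Real.sqrt (∫ x, (1 + dist x x₀) ^ 2 / η x ∂α)) *
                QSD.chi2 (QSD.weighted η μ) (QSD.weighted η α) *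
                ENNReal.ofReal (Real.exp (-(t : ℝ) / C)) := by
  refine ⟨2, 2, two_pos, two_pos, ?_⟩
  intro S Ω _ _ _ _ cem Z α η lam C x₀ h μ _ htop
  exact h.exists_wasserstein1_condLaw_le (fun x => le_add_of_nonneg_left zero_le_one) htop
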